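/- Let $G=\{e,a,a^2,a^3\}$ be the cyclic group of order $4$ generated by $a$. Let $A=\begin{pmatrix}1&0\\0&-1\end{pmatrix}$, $B=\begin{pmatrix}0&1\\1&0\end{pmatrix}$, $C=AB=\begin{pmatrix}0&1\\-1&0\end{pmatrix}$ and $\omega=\frac{1}{\sqrt2}(1+i)$, and denote by $M_2(\mathbb{C},\mathbb{Z}_4)$ the real algebra $M_2(\mathbb{C})$ with the grading by the cyclic group of order $4$ whose homogeneous components of degree $e,a,a^2,a^3$ are the real spans $$\langle I,C\rangle,\quad \langle \omega A,\omega B\rangle,\quad \langle iI,iC\rangle,\quad \langle i\omega A,i\omega B\rangle .$$ Let $R=\bigoplus_{g\in G}R_g$ be the real algebra $M_2(\mathbb{C})$ with a $G$-grading weakly isomorphic to $M_2(\mathbb{C},\mathbb{Z}_4)$, i.e. there are a group isomorphism $\alpha$ and an isomorphism of real algebras $\varphi$ with $\varphi(R_g)=M_2(\mathbb{C},\mathbb{Z}_4)_{\alpha(g)}$ for all $g$. Let $\mathbb{R}\langle X_G\rangle$ be the free unital associative algebra on the variables $x_{i,g}$ ($i\in\mathbb{N}$, $g\in G$), graded by letting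 $x_{i,g}$ have degree $g$. A polynomial $f\in\mathbb{R}\langle X_G\rangle$ is a graded identity (respectively, a graded central polynomial) of $R$ if it takes the value $0$ (respectively, a value in the centre of $R$) whenever each variable $x_{i,g}$ is replaced by an element of $R_g$. A $T_G$-ideal (respectively, $T_G$-space) is a two-sided ideal (respectively, a linear subspace) of $\mathbb{R}\langle X_G\rangle$ that is invariant under all degree-preserving algebra endomorphisms, and a basis of it is a subset such that it is the smallest $T_G$-ideal (respectively, $T_G$-space) containing that subset. Write $[u,v]=uv-vu$. Then: (i) the polynomials $$[x_{1,k_1},x_{2,k_2}],\qquad x_{1,h_1}x_{2,h_2}x_{3,h_3}-x_{3,h_3}x_{2,h_2}x_{1,h_1},$$ with $k_1,k_2\in\{e,a^2\}$ and $h_1,h_2,h_3\in\{a,a^3\}$, form a basis of the $T_G$-ideal of graded identities of $R$; (ii) the constant $1$ and the polynomials $$x_{1,h_1}x_{2,h_2}+x_{2,h_2}x_{1,h_1},\qquad x_{1,g_1}[x_{2,k_2},x_{3,k_3}]x_{4,g_4},\qquad x_{1,g_1}\left(x_{2,h_2}x_{3,h_3}x_{4,h_4}-x_{4,h_4}x_{3,h_3}x_{2,h_2}\right)x_{5,g_5},$$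 with $k_2,k_3\in\{e,a^2\}$, $h_1,h_2,h_3,h_4\in\{a,a^3\}$ and $g_1,g_4,g_5\in G$, form a basis of the $T_G$-space of graded central polynomials of $R$. -/

import Mathlib

/-!
Graded polynomial identities and graded central polynomials of algebras graded by a group
(written additively), and the division grading of `M₂(ℂ)`, as a real algebra, by the cyclic group
of order four.
-/

namespace GradedPI

section General

variable (K : Type*) [Field K] (G : Type*) [AddGroup G]

/-- The free unital associative algebra `K⟨X_G⟩` on the variables `x_{i,g}`, `i ∈ ℕ`, `g ∈ G`. -/
abbrev FreeGr := FreeAlgebra K (ℕ × G)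

variable {G}

/-- The variable `x_{i,g}`. -/
def x (i : ℕ) (g : G) : FreeGr K G := FreeAlgebra.ι K (i, g)

/-- The homogeneous component of degree `g` of `K⟨X_G⟩`: the subspace spanned by the monomials
`x_{i₁,g₁} ⋯ x_{iₘ,gₘ}` (with `m ≥ 0`) such that `g₁ + ⋯ + gₘ = g`. -/
def component (g : G) : Submodule K (FreeGr K G) :=
  Submodule.span K
    {f | ∃ l : List (ℕ × G), (l.map Prod.snd).sum = g ∧ f = (l.map (FreeAlgebra.ι K)).prod}

variable {K}

/-- Graded (that is, degree preserving) endomorphisms of `K⟨X_G⟩`. -/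
def IsGradedEnd (φ : FreeGr K G →ₐ[K] FreeGr K G) : Prop :=
  ∀ g : G, ∀ f ∈ component K g, φ f ∈ component K g

/-- A `T_G`-ideal: a two-sided ideal of `K⟨X_G⟩` invariant under all graded endomorphisms. -/
def IsTIdeal (I : TwoSidedIdeal (FreeGr K G)) : Prop :=
  ∀ φ : FreeGr K G →ₐ[K] FreeGr K G, IsGradedEnd φ → ∀ f ∈ I, φ f ∈ I

/-- A `T_G`-space: a subspace of `K⟨X_G⟩` invariant under all graded endomorphisms. -/
def IsTSpace (V : Submodule K (FreeGr K G)) : Prop :=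
  ∀ φ : FreeGr K G →ₐ[K] FreeGr K G, IsGradedEnd φ → ∀ f ∈ V, φ f ∈ V

/-- The `T_G`-ideal generated by `S`: the intersection of all `T_G`-ideals containing `S`. -/
def tIdealSpan (S : Set (FreeGr K G)) : TwoSidedIdeal (FreeGr K G) :=
  sInf {I | IsTIdeal I ∧ ∀ f ∈ S, f ∈ I}

/-- The `T_G`-space generated by `S`: the intersection of all `T_G`-spaces containing `S`. -/
def tSpaceSpan (S : Set (FreeGr K G)) : Submodule K (FreeGr K G) :=
  sInf {V | IsTSpace V ∧ ∀ f ∈ S, f ∈ V}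

variable {A : Type*} [Ring A] [Algebra K A]

/-- Admissible substitutions: each variable `x_{i,g}` is replaced by an element of degree `g`. -/
def IsAdmissible (𝒜 : G → Submodule K A) (v : ℕ × G → A) : Prop :=
  ∀ i g, v (i, g) ∈ 𝒜 g

/-- The set `Id_G(A)` of graded polynomial identities of `A = ⨁ 𝒜 g`. -/
def gradedIdentities (𝒜 : G → Submodule K A) : Set (FreeGr K G) :=
  {f | ∀ v : ℕ × G → A, IsAdmissible 𝒜 v → FreeAlgebra.lift K v f = 0}

/-- The set `C_G(A)` of graded central polynomials of `A = ⨁ 𝒜 g`. -/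
def gradedCentralPolynomials (𝒜 : G → Submodule K A) : Set (FreeGr K G) :=
  {f | ∀ v : ℕ × G → A, IsAdmissible 𝒜 v → FreeAlgebra.lift K v f ∈ Subalgebra.center K A}

/-- `S` is a basis (that is, a generating set) of the `T_G`-ideal of graded identities. -/
def IsBasisOfIdentities (𝒜 : G → Submodule K A) (S : Set (FreeGr K G)) : Prop :=
  gradedIdentities 𝒜 = (tIdealSpan S : Set (FreeGr K G))

/-- `S` is a basis (that is, a generating set) of the `T_G`-space of graded central
polynomials. -/
def IsBasisOfCentralPolynomials (𝒜 : G → Submodule K A) (S : Set (FreeGr K G)) : Prop :=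
  gradedCentralPolynomials 𝒜 = (tSpaceSpan S : Set (FreeGr K G))

/-- Weak isomorphism of graded algebras: a group isomorphism together with an algebra isomorphism
that carries each homogeneous component onto the corresponding one. -/
def WeaklyIsomorphic {H B : Type*} [AddGroup H] [Ring B] [Algebra K B]
    [DecidableEq G] [DecidableEq H]
    (𝒜 : G → Submodule K A) [GradedAlgebra 𝒜] (ℬ : H → Submodule K B) [GradedAlgebra ℬ] : Prop :=
  ∃ (α : G ≃+ H) (φ : A ≃ₐ[K] B), ∀ g, (𝒜 g).map φ.toLinearMap = ℬ (α g)

end General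

section M2C

open Matrix

noncomputable section

/-- The algebra `M₂(ℂ)`, regarded below as an algebra over `ℝ`. -/
abbrev M2C := Matrix (Fin 2) (Fin 2) ℂ

/-- The first Sylvester matrix. -/
def matA : M2C := !![1, 0; 0, -1]

/-- The second Sylvester matrix. -/
def matB : M2C := !![0, 1; 1, 0]

/-- The product of the two Sylvester matrices. -/
def matC : M2C := !![0, 1; -1, 0]

/-- The eighth root of unity `ω = (1 + i)/√2`, with `ω² = i`. -/
def om : ℂ := ((1 / Real.sqrt 2 : ℝ) : ℂ) * (1 + Complex.I)

/-- The real algebra `M₂(ℂ)` with its division grading by `ℤ/4`: the components of degree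
`0, 1, 2, 3` are the real spans of `I, C`, of `ωA, ωB`, of `iI, iC` and of `iωA, iωB`. -/
def m2cZ4 : ZMod 4 → Submodule ℝ M2C :=
  (![Submodule.span ℝ {1, matC},
    Submodule.span ℝ {om • matA, om • matB},
    Submodule.span ℝ {Complex.I • (1 : M2C), Complex.I • matC},
    Submodule.span ℝ {(Complex.I * om) • matA, (Complex.I * om) • matB}] : Fin 4 → _)

theorem om_sq : om * om = Complex.I := by
  have h : ((1 / Real.sqrt 2 : ℝ) : ℂ) * ((1 / Real.sqrt 2 : ℝ) : ℂ) = 1 / 2 := by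
    rw [← Complex.ofReal_mul]
    have : (1 / Real.sqrt 2) * (1 / Real.sqrt 2) = (1 / 2 : ℝ) := by
      rw [div_mul_div_comm, Real.mul_self_sqrt (by norm_num)]; norm_num
    rw [this]; norm_num
  have hI := Complex.I_mul_I
  unfold om
  linear_combination (1 + Complex.I) * (1 + Complex.I) * h + (1 / 2) * hI

theorem om_ne_zero : om ≠ 0 := by
  intro h
  have := om_sq
  rw [h] at this
  simp at this
  exact Complex.I_ne_zero this.symm

theorem mem_m2cZ4_zero (M : M2C) :
    M ∈ m2cZ4 0 ↔ ∃ p q : ℝ, M = !![(p : ℂ), q; -q, p] := by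
  change M ∈ Submodule.span ℝ {1, matC} ↔ _
  rw [Submodule.mem_span_pair]
  refine exists_congr fun p => exists_congr fun q => ?_
  rw [eq_comm]
  have : p • (1 : M2C) + q • matC = !![(p : ℂ), q; -q, p] := by
    ext i j; fin_cases i <;> fin_cases j <;> simp [matC]
  rw [this]

theorem mem_m2cZ4_one (M : M2C) :
    M ∈ m2cZ4 1 ↔ ∃ p q : ℝ, M = !![om * p, om * q; om * q, -(om * p)] := by
  change M ∈ Submodule.span ℝ {om • matA, om • matB} ↔ _
  rw [Submodule.mem_span_pair]
  refine exists_congr fun p => exists_congr fun q => ?_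
  rw [eq_comm]
  have : p • (om • matA) + q • (om • matB) = !![om * p, om * q; om * q, -(om * p)] := by
    ext i j; fin_cases i <;> fin_cases j <;> simp [matA, matB, mul_comm]
  rw [this]

theorem mem_m2cZ4_two (M : M2C) :
    M ∈ m2cZ4 2 ↔ ∃ p q : ℝ, M = !![Complex.I * p, Complex.I * q;
      -(Complex.I * q), Complex.I * p] := by
  change M ∈ Submodule.span ℝ {Complex.I • (1 : M2C), Complex.I • matC} ↔ _
  rw [Submodule.mem_span_pair]
  refine exists_congr fun p => exists_congr fun q => ?_
  rw [eq_comm]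
  have : p • (Complex.I • (1 : M2C)) + q • (Complex.I • matC) = !![Complex.I * p, Complex.I * q;
      -(Complex.I * q), Complex.I * p] := by
    ext i j; fin_cases i <;> fin_cases j <;> simp [matC, mul_comm]
  rw [this]

theorem mem_m2cZ4_three (M : M2C) :
    M ∈ m2cZ4 3 ↔ ∃ p q : ℝ, M = !![Complex.I * om * p, Complex.I * om * q;
      Complex.I * om * q, -(Complex.I * om * p)] := by
  change M ∈ Submodule.span ℝ {(Complex.I * om) • matA, (Complex.I * om) • matB} ↔ _
  rw [Submodule.mem_span_pair]
  refine exists_congr fun p => exists_congr fun q => ?_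
  rw [eq_comm]
  have : p • ((Complex.I * om) • matA) + q • ((Complex.I * om) • matB) =
      !![Complex.I * om * p, Complex.I * om * q;
      Complex.I * om * q, -(Complex.I * om * p)] := by
    ext i j; fin_cases i <;> fin_cases j <;> simp [matA, matB, mul_comm]
  rw [this]

theorem m2cZ4_indep (M : ∀ g, m2cZ4 g)
    (h : (M 0 : M2C) + M 1 + M 2 + M 3 = 0) : M = 0 := by
  obtain ⟨p₀, q₀, h₀⟩ := (mem_m2cZ4_zero _).1 (M 0).2
  obtain ⟨p₁, q₁, h₁⟩ := (mem_m2cZ4_one _).1 (M 1).2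
  obtain ⟨p₂, q₂, h₂⟩ := (mem_m2cZ4_two _).1 (M 2).2
  obtain ⟨p₃, q₃, h₃⟩ := (mem_m2cZ4_three _).1 (M 3).2
  rw [h₀, h₁, h₂, h₃] at h
  have e00 := congrFun (congrFun h 0) 0
  have e01 := congrFun (congrFun h 0) 1
  have e10 := congrFun (congrFun h 1) 0
  have e11 := congrFun (congrFun h 1) 1
  simp at e00 e01 e10 e11
  have key : ∀ p q : ℝ, (p : ℂ) + Complex.I * q = 0 → p = 0 ∧ q = 0 := by
    intro p q hpq
    have hr := congrArg Complex.re hpq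
    have hi := congrArg Complex.im hpq
    simp at hr hi
    exact ⟨hr, hi⟩
  have k1 := key p₀ p₂ (by linear_combination (e00 + e11) / 2)
  have k2 := key q₀ q₂ (by linear_combination (e01 - e10) / 2)
  have k3 := key p₁ p₃ (mul_left_cancel₀ om_ne_zero (by linear_combination (e00 - e11) / 2))
  have k4 := key q₁ q₃ (mul_left_cancel₀ om_ne_zero (by linear_combination (e01 + e10) / 2))
  funext g
  apply Subtype.ext
  change (M g : M2C) = 0
  fin_cases g
  · change (M 0 : M2C) = 0
    rw [h₀, k1.1, k2.1]; ext i j; fin_cases i <;> fin_cases j <;> simp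
  · change (M 1 : M2C) = 0
    rw [h₁, k3.1, k4.1]; ext i j; fin_cases i <;> fin_cases j <;> simp
  · change (M 2 : M2C) = 0
    rw [h₂, k1.2, k2.2]; ext i j; fin_cases i <;> fin_cases j <;> simp
  · change (M 3 : M2C) = 0
    rw [h₃, k3.2, k4.2]; ext i j; fin_cases i <;> fin_cases j <;> simp

theorem m2cZ4_exists (N : M2C) : ∃ n₀ ∈ m2cZ4 0, ∃ n₁ ∈ m2cZ4 1, ∃ n₂ ∈ m2cZ4 2,
    ∃ n₃ ∈ m2cZ4 3, n₀ + n₁ + n₂ + n₃ = N := by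
  have key : ∀ z : ℂ, (z.re : ℂ) + Complex.I * z.im = z := fun z => by
    rw [mul_comm]; exact Complex.re_add_im z
  refine ⟨_, (mem_m2cZ4_zero _).2 ⟨((N 0 0 + N 1 1) / 2).re, ((N 0 1 - N 1 0) / 2).re, rfl⟩,
    _, (mem_m2cZ4_one _).2
      ⟨((N 0 0 - N 1 1) / 2 / om).re, ((N 0 1 + N 1 0) / 2 / om).re, rfl⟩,
    _, (mem_m2cZ4_two _).2 ⟨((N 0 0 + N 1 1) / 2).im, ((N 0 1 - N 1 0) / 2).im, rfl⟩,
    _, (mem_m2cZ4_three _).2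
      ⟨((N 0 0 - N 1 1) / 2 / om).im, ((N 0 1 + N 1 0) / 2 / om).im, rfl⟩, ?_⟩
  have k1 := key ((N 0 0 + N 1 1) / 2)
  have k2 := key ((N 0 1 - N 1 0) / 2)
  have k3 := key ((N 0 0 - N 1 1) / 2 / om)
  have k4 := key ((N 0 1 + N 1 0) / 2 / om)
  have c3 : om * ((N 0 0 - N 1 1) / 2 / om) = (N 0 0 - N 1 1) / 2 :=
    mul_div_cancel₀ _ om_ne_zero
  have c4 : om * ((N 0 1 + N 1 0) / 2 / om) = (N 0 1 + N 1 0) / 2 :=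
    mul_div_cancel₀ _ om_ne_zero
  generalize (N 0 0 - N 1 1) / 2 / om = z3 at *
  generalize (N 0 1 + N 1 0) / 2 / om = z4 at *
  generalize h1 : (N 0 0 + N 1 1) / 2 = z1 at *
  generalize h2 : (N 0 1 - N 1 0) / 2 = z2 at *
  ext i j
  fin_cases i <;> fin_cases j <;> simp
  · linear_combination k1 + om * k3 + c3 - h1
  · linear_combination k2 + om * k4 + c4 - h2
  · linear_combination -k2 + om * k4 + c4 + h2
  · linear_combination k1 - om * k3 - c3 - h1

theorem m2cZ4_coe (M : DirectSum (ZMod 4) fun g => m2cZ4 g) :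
    DirectSum.coeAddMonoidHom m2cZ4 M = (M 0 : M2C) + M 1 + M 2 + M 3 := by
  induction M using DirectSum.induction_on with
  | zero => simp
  | of i y =>
    rw [DirectSum.coeAddMonoidHom_of]
    have h : ∀ j, ((DirectSum.of (fun g => m2cZ4 g) i y) j : M2C) = if i = j then (y : M2C) else 0 :=
      fun j => (DirectSum.coe_of_apply i j y).trans (by split_ifs <;> rfl)
    simp only [h]
    have d : ∀ i : ZMod 4, i = 0 ∨ i = 1 ∨ i = 2 ∨ i = 3 := by decide
    have e1 : (0 : ZMod 4) ≠ 1 ∧ (0 : ZMod 4) ≠ 2 ∧ (0 : ZMod 4) ≠ 3 ∧ (1 : ZMod 4) ≠ 2 ∧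
      (1 : ZMod 4) ≠ 3 ∧ (2 : ZMod 4) ≠ 3 := by decide
    obtain ⟨h1, h2, h3, h4, h5, h6⟩ := e1
    rcases d i with rfl | rfl | rfl | rfl <;>
      simp [h1, h2, h3, h4, h5, h6, h1.symm, h2.symm, h3.symm, h4.symm, h5.symm, h6.symm]
  | add u v hu hv => 
    rw [map_add, hu, hv]
    simp only [DirectSum.add_apply, Submodule.coe_add]
    abel

theorem m2cZ4_isInternal : DirectSum.IsInternal m2cZ4 := by
  constructor
  · rw [injective_iff_map_eq_zero]
    intro M hM
    rw [m2cZ4_coe] at hM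
    have := m2cZ4_indep (fun g => M g) hM
    exact DFinsupp.ext fun g => congrFun this g
  · intro N
    obtain ⟨n₀, h₀, n₁, h₁, n₂, h₂, n₃, h₃, h⟩ := m2cZ4_exists N
    refine ⟨DirectSum.of (fun g => m2cZ4 g) 0 ⟨n₀, h₀⟩ + DirectSum.of (fun g => m2cZ4 g) 1 ⟨n₁, h₁⟩
      + DirectSum.of (fun g => m2cZ4 g) 2 ⟨n₂, h₂⟩ + DirectSum.of (fun g => m2cZ4 g) 3 ⟨n₃, h₃⟩, ?_⟩
    simp only [map_add, DirectSum.coeAddMonoidHom_of]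
    exact h

theorem m2cZ4_mul (g h : ZMod 4) (M N : M2C) (hM : M ∈ m2cZ4 g) (hN : N ∈ m2cZ4 h) :
    M * N ∈ m2cZ4 (g + h) := by
  have hI := Complex.I_mul_I
  have ho := om_sq
  have d : ∀ i : ZMod 4, i = 0 ∨ i = 1 ∨ i = 2 ∨ i = 3 := by decide
  have mk : ∀ {a b c d a' b' c' d' : ℂ}, a = a' → b = b' → c = c' → d = d' →
      !![a, b; c, d] = !![a', b'; c', d'] := by
    rintro _ _ _ _ _ _ _ _ rfl rfl rfl rfl; rfl
  rcases d g with rfl | rfl | rfl | rfl <;> rcases d h with rfl | rfl | rfl | rfl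
  · obtain ⟨p, q, rfl⟩ := (mem_m2cZ4_zero _).1 hM
    obtain ⟨p', q', rfl⟩ := (mem_m2cZ4_zero _).1 hN
    refine (mem_m2cZ4_zero _).2 ⟨p * p' - q * q', p * q' + q * p', ?_⟩
    rw [Matrix.mul_fin_two]
    push_cast
    refine mk ?_ ?_ ?_ ?_ <;> ring
  · obtain ⟨p, q, rfl⟩ := (mem_m2cZ4_zero _).1 hM
    obtain ⟨p', q', rfl⟩ := (mem_m2cZ4_one _).1 hN
    refine (mem_m2cZ4_one _).2 ⟨p * p' + q * q', p * q' - q * p', ?_⟩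
    rw [Matrix.mul_fin_two]
    push_cast
    refine mk ?_ ?_ ?_ ?_ <;> ring
  · obtain ⟨p, q, rfl⟩ := (mem_m2cZ4_zero _).1 hM
    obtain ⟨p', q', rfl⟩ := (mem_m2cZ4_two _).1 hN
    refine (mem_m2cZ4_two _).2 ⟨p * p' - q * q', p * q' + q * p', ?_⟩
    rw [Matrix.mul_fin_two]
    push_cast
    refine mk ?_ ?_ ?_ ?_ <;> ring
  · obtain ⟨p, q, rfl⟩ := (mem_m2cZ4_zero _).1 hM
    obtain ⟨p', q', rfl⟩ := (mem_m2cZ4_three _).1 hN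
    refine (mem_m2cZ4_three _).2 ⟨p * p' + q * q', p * q' - q * p', ?_⟩
    rw [Matrix.mul_fin_two]
    push_cast
    refine mk ?_ ?_ ?_ ?_ <;> ring
  · obtain ⟨p, q, rfl⟩ := (mem_m2cZ4_one _).1 hM
    obtain ⟨p', q', rfl⟩ := (mem_m2cZ4_zero _).1 hN
    refine (mem_m2cZ4_one _).2 ⟨p * p' - q * q', p * q' + q * p', ?_⟩
    rw [Matrix.mul_fin_two]
    push_cast
    refine mk ?_ ?_ ?_ ?_ <;> ring
  · obtain ⟨p, q, rfl⟩ := (mem_m2cZ4_one _).1 hM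
    obtain ⟨p', q', rfl⟩ := (mem_m2cZ4_one _).1 hN
    refine (mem_m2cZ4_two _).2 ⟨p * p' + q * q', p * q' - q * p', ?_⟩
    rw [Matrix.mul_fin_two]
    push_cast
    refine mk ?_ ?_ ?_ ?_
    · linear_combination (p * p' + q * q') * ho
    · linear_combination (p * q' - q * p') * ho
    · linear_combination (-(p * q' - q * p')) * ho
    · linear_combination (p * p' + q * q') * ho
  · obtain ⟨p, q, rfl⟩ := (mem_m2cZ4_one _).1 hM
    obtain ⟨p', q', rfl⟩ := (mem_m2cZ4_two _).1 hN
    refine (mem_m2cZ4_three _).2 ⟨p * p' - q * q', p * q' + q * p', ?_⟩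
    rw [Matrix.mul_fin_two]
    push_cast
    refine mk ?_ ?_ ?_ ?_ <;> ring
  · obtain ⟨p, q, rfl⟩ := (mem_m2cZ4_one _).1 hM
    obtain ⟨p', q', rfl⟩ := (mem_m2cZ4_three _).1 hN
    refine (mem_m2cZ4_zero _).2 ⟨-(p * p' + q * q'), -(p * q' - q * p'), ?_⟩
    rw [Matrix.mul_fin_two]
    push_cast
    refine mk ?_ ?_ ?_ ?_
    · linear_combination Complex.I * (p * p' + q * q') * ho + (p * p' + q * q') * hI
    · linear_combination Complex.I * (p * q' - q * p') * ho + (p * q' - q * p') * hI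
    · linear_combination Complex.I * (-(p * q' - q * p')) * ho + (-(p * q' - q * p')) * hI
    · linear_combination Complex.I * (p * p' + q * q') * ho + (p * p' + q * q') * hI
  · obtain ⟨p, q, rfl⟩ := (mem_m2cZ4_two _).1 hM
    obtain ⟨p', q', rfl⟩ := (mem_m2cZ4_zero _).1 hN
    refine (mem_m2cZ4_two _).2 ⟨p * p' - q * q', p * q' + q * p', ?_⟩
    rw [Matrix.mul_fin_two]
    push_cast
    refine mk ?_ ?_ ?_ ?_ <;> ring
  · obtain ⟨p, q, rfl⟩ := (mem_m2cZ4_two _).1 hM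
    obtain ⟨p', q', rfl⟩ := (mem_m2cZ4_one _).1 hN
    refine (mem_m2cZ4_three _).2 ⟨p * p' + q * q', p * q' - q * p', ?_⟩
    rw [Matrix.mul_fin_two]
    push_cast
    refine mk ?_ ?_ ?_ ?_ <;> ring
  · obtain ⟨p, q, rfl⟩ := (mem_m2cZ4_two _).1 hM
    obtain ⟨p', q', rfl⟩ := (mem_m2cZ4_two _).1 hN
    refine (mem_m2cZ4_zero _).2 ⟨-(p * p' - q * q'), -(p * q' + q * p'), ?_⟩
    rw [Matrix.mul_fin_two]
    push_cast
    refine mk ?_ ?_ ?_ ?_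
    · linear_combination (p * p' - q * q') * hI
    · linear_combination (p * q' + q * p') * hI
    · linear_combination (-(p * q' + q * p')) * hI
    · linear_combination (p * p' - q * q') * hI
  · obtain ⟨p, q, rfl⟩ := (mem_m2cZ4_two _).1 hM
    obtain ⟨p', q', rfl⟩ := (mem_m2cZ4_three _).1 hN
    refine (mem_m2cZ4_one _).2 ⟨-(p * p' + q * q'), -(p * q' - q * p'), ?_⟩
    rw [Matrix.mul_fin_two]
    push_cast
    refine mk ?_ ?_ ?_ ?_
    · linear_combination om * (p * p' + q * q') * hI
    · linear_combination om * (p * q' - q * p') * hI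
    · linear_combination om * (p * q' - q * p') * hI
    · linear_combination om * (-(p * p' + q * q')) * hI
  · obtain ⟨p, q, rfl⟩ := (mem_m2cZ4_three _).1 hM
    obtain ⟨p', q', rfl⟩ := (mem_m2cZ4_zero _).1 hN
    refine (mem_m2cZ4_three _).2 ⟨p * p' - q * q', p * q' + q * p', ?_⟩
    rw [Matrix.mul_fin_two]
    push_cast
    refine mk ?_ ?_ ?_ ?_ <;> ring
  · obtain ⟨p, q, rfl⟩ := (mem_m2cZ4_three _).1 hM
    obtain ⟨p', q', rfl⟩ := (mem_m2cZ4_one _).1 hN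
    refine (mem_m2cZ4_zero _).2 ⟨-(p * p' + q * q'), -(p * q' - q * p'), ?_⟩
    rw [Matrix.mul_fin_two]
    push_cast
    refine mk ?_ ?_ ?_ ?_
    · linear_combination Complex.I * (p * p' + q * q') * ho + (p * p' + q * q') * hI
    · linear_combination Complex.I * (p * q' - q * p') * ho + (p * q' - q * p') * hI
    · linear_combination Complex.I * (-(p * q' - q * p')) * ho + (-(p * q' - q * p')) * hI
    · linear_combination Complex.I * (p * p' + q * q') * ho + (p * p' + q * q') * hI
  · obtain ⟨p, q, rfl⟩ := (mem_m2cZ4_three _).1 hM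
    obtain ⟨p', q', rfl⟩ := (mem_m2cZ4_two _).1 hN
    refine (mem_m2cZ4_one _).2 ⟨-(p * p' - q * q'), -(p * q' + q * p'), ?_⟩
    rw [Matrix.mul_fin_two]
    push_cast
    refine mk ?_ ?_ ?_ ?_
    · linear_combination om * (p * p' - q * q') * hI
    · linear_combination om * (p * q' + q * p') * hI
    · linear_combination om * (p * q' + q * p') * hI
    · linear_combination om * (-(p * p' - q * q')) * hI
  · obtain ⟨p, q, rfl⟩ := (mem_m2cZ4_three _).1 hM
    obtain ⟨p', q', rfl⟩ := (mem_m2cZ4_three _).1 hN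
    refine (mem_m2cZ4_two _).2 ⟨-(p * p' + q * q'), -(p * q' - q * p'), ?_⟩
    rw [Matrix.mul_fin_two]
    push_cast
    refine mk ?_ ?_ ?_ ?_
    · linear_combination Complex.I * Complex.I * (p * p' + q * q') * ho + Complex.I * (p * p' + q * q') * hI
    · linear_combination Complex.I * Complex.I * (p * q' - q * p') * ho + Complex.I * (p * q' - q * p') * hI
    · linear_combination Complex.I * Complex.I * (-(p * q' - q * p')) * ho + Complex.I * (-(p * q' - q * p')) * hI
    · linear_combination Complex.I * Complex.I * (p * p' + q * q') * ho + Complex.I * (p * p' + q * q') * hI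

/-- The family `m2cZ4` is a grading of the real algebra `M₂(ℂ)` by `ℤ/4`. -/
instance : GradedAlgebra m2cZ4 :=
  letI : DirectSum.Decomposition m2cZ4 := m2cZ4_isInternal.chooseDecomposition
  { one_mem := Submodule.subset_span (by simp)
    mul_mem := fun {g h M N} hM hN => m2cZ4_mul g h M N hM hN }

end

end M2C

end GradedPI

/-! Let even and odd refer to the parity of the degree in `ZMod 4`. The matrices of even degree
share the left eigenvectors (1, -i) and (1, i), and those of odd degree exchange the two eigenlines.
Up to the fixed scalar `weight g`, an element of degree g acts on the first vector by an arbitrary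
complex number z and on the second by its conjugate. A monomial therefore acts on the first vector
by a nonzero constant times a product of factors z_l or conj z_l, one per letter l, conjugated
exactly when the prefix before that letter is odd. The multiset of letters with these prefix
parities is the profile of the word.

Two facts make the profile a complete invariant. Combinatorially, words with the same profile are
joined by swaps of adjacent even blocks and reversals of three consecutive odd blocks
(`rel_of_profile_eq`); these are the consequences of the listed identities. Analytically, distinct
profiles give distinct multiplicative characters of L → ℂ, which are linearly independent by
Dedekind (`linearIndependent_profileChar`). So in a graded identity the coefficients over each
profile sum to zero, which gives (i).

A central value is a scalar matrix: it has no part exchanging the eigenlines, and it acts equally on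
both vectors. Hence in a central polynomial the odd profiles have total coefficient zero, and the
coefficients are invariant under flipping all prefix parities. If u and w are odd, this flip takes
the profile of uw to that of wu, so f is, modulo identities, a combination of sums uw + wu and of
constants. Nonempty words in even letters drop out because their flipped profile belongs to no word.
This gives (ii). -/

namespace GradedPI

/-! ### Combinatorics of words and their profiles -/

section Words

variable {L : Type*}

/-- The parity of a word, with respect to a parity function on its letters. -/
def wordParity (π : L → ZMod 2) (w : List L) : ZMod 2 := (w.map π).sum

/-- The multiset of the letters of a word, each with the parity of the prefix that precedes it
(shifted by `ε`). -/
def profile (π : L → ZMod 2) : ZMod 2 → List L → Multiset (L × ZMod 2)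
  | _, [] => 0
  | ε, l :: w => (l, ε) ::ₘ profile π (ε + π l) w

/-- The involution that changes all parities in a profile. -/
def profileConj (t : Multiset (L × ZMod 2)) : Multiset (L × ZMod 2) :=
  t.map fun p => (p.1, p.2 + 1)

/-- The parity of a profile. -/
def profileParity (π : L → ZMod 2) (t : Multiset (L × ZMod 2)) : ZMod 2 :=
  (t.map fun p => π p.1).sum

variable (π : L → ZMod 2)

theorem ZMod.two_cases (a : ZMod 2) : a = 0 ∨ a = 1 := by
  revert a; decide

@[simp] theorem wordParity_nil : wordParity π [] = 0 := rfl

@[simp] theorem wordParity_cons (l : L) (w : List L) :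
    wordParity π (l :: w) = π l + wordParity π w := by
  simp [wordParity]

@[simp] theorem wordParity_append (u w : List L) :
    wordParity π (u ++ w) = wordParity π u + wordParity π w := by
  simp [wordParity]

@[simp] theorem profile_nil (ε : ZMod 2) : profile π ε [] = 0 := rfl

@[simp] theorem profile_cons (ε : ZMod 2) (l : L) (w : List L) :
    profile π ε (l :: w) = (l, ε) ::ₘ profile π (ε + π l) w := rfl

theorem profile_append (ε : ZMod 2) (u w : List L) :
    profile π ε (u ++ w) = profile π ε u + profile π (ε + wordParity π u) w := by
  induction u generalizing ε with
  | nil => simp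
  | cons l u ih => simp [ih, add_assoc]

theorem profile_add_one (ε : ZMod 2) (w : List L) :
    profile π (ε + 1) w = profileConj (profile π ε w) := by
  induction w generalizing ε with
  | nil => rfl
  | cons l w ih =>
    rw [profile_cons, profile_cons, add_right_comm, ih]
    simp [profileConj]

theorem profileConj_profileConj (t : Multiset (L × ZMod 2)) :
    profileConj (profileConj t) = t := by
  have h : ∀ e : ZMod 2, e + 1 + 1 = e := by decide
  simp [profileConj, Multiset.map_map, h]

theorem profileParity_profile (ε : ZMod 2) (w : List L) :
    profileParity π (profile π ε w) = wordParity π w := by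
  induction w generalizing ε with
  | nil => rfl
  | cons l w ih =>
    have := ih (ε + π l)
    simp only [profileParity] at this
    simp [profileParity, this]

theorem profileParity_profileConj (t : Multiset (L × ZMod 2)) :
    profileParity π (profileConj t) = profileParity π t := by
  simp [profileParity, profileConj, Multiset.map_map]

theorem map_fst_profile (ε : ZMod 2) (w : List L) :
    (profile π ε w).map Prod.fst = (w : Multiset L) := by
  induction w generalizing ε with
  | nil => rfl
  | cons l w ih => simp [ih]

theorem mem_profile {ε δ : ZMod 2} {l : L} {w : List L} (h : (l, δ) ∈ profile π ε w) :
    ∃ p s, w = p ++ l :: s ∧ δ = ε + wordParity π p := by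
  induction w generalizing ε with
  | nil => simp at h
  | cons y w ih =>
    rw [profile_cons, Multiset.mem_cons] at h
    rcases h with h | h
    · obtain ⟨rfl, rfl⟩ := Prod.mk.inj h
      exact ⟨[], w, rfl, by simp⟩
    · obtain ⟨p, s, rfl, rfl⟩ := ih h
      exact ⟨y :: p, s, rfl, by simp [add_assoc]⟩

theorem forall_even_or_exists_first_odd (w : List L) :
    (∀ l ∈ w, π l = 0) ∨ ∃ p y s, w = p ++ y :: s ∧ wordParity π p = 0 ∧ π y = 1 := by
  induction w with
  | nil => simp
  | cons l w ih =>
    rcases ZMod.two_cases (π l) with hl | hl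
    · rcases ih with h | ⟨p, y, s, rfl, hp, hy⟩
      · exact Or.inl (by simpa [hl] using h)
      · exact Or.inr ⟨l :: p, y, s, rfl, by simp [hl, hp], hy⟩
    · exact Or.inr ⟨[], l, w, rfl, rfl, hl⟩

theorem wordParity_eq_zero_of_forall {w : List L} (h : ∀ l ∈ w, π l = 0) :
    wordParity π w = 0 :=
  List.sum_eq_zero (by simpa using h)

/-- An even block does not alter the parity at which the following letters are read. -/
theorem profile_swap_even (ε : ZMod 2) {u v : List L} (hu : wordParity π u = 0)
    (hv : wordParity π v = 0) (s : List L) :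
    profile π ε (u ++ v ++ s) = profile π ε (v ++ u ++ s) := by
  simp only [profile_append, wordParity_append, hu, hv, add_zero]
  abel

/-- The two outer blocks are both read from ε and the middle one from ε + 1, in either order. -/
theorem profile_swap_odd (ε : ZMod 2) {u v w : List L} (hu : wordParity π u = 1)
    (hv : wordParity π v = 1) (hw : wordParity π w = 1) (s : List L) :
    profile π ε (u ++ v ++ w ++ s) = profile π ε (w ++ v ++ u ++ s) := by
  have h : ε + (1 + 1) = ε := by rw [show (1 + 1 : ZMod 2) = 0 from rfl, add_zero]
  simp only [profile_append, wordParity_append, hu, hv, hw, h]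
  abel

/-- Exchanging two odd blocks makes each start at the opposite parity. This is the source of the
anticommutators among the central polynomials. -/
theorem profileConj_profile_append {u w : List L} (hu : wordParity π u = 1)
    (hw : wordParity π w = 1) :
    profileConj (profile π 0 (u ++ w)) = profile π 0 (w ++ u) := by
  rw [← profile_add_one, profile_append, profile_append, hu, hw]
  simp only [zero_add, show (1 + 1 : ZMod 2) = 0 from rfl]
  rw [add_comm]

/-- Words with the same profile are congruent modulo the commutation of even words and the
reversal of products of three odd words. -/
theorem rel_of_profile_eq (r : List L → List L → Prop) (hrefl : ∀ w, r w w)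
    (htrans : ∀ u v w, r u v → r v w → r u w)
    (hcons : ∀ l u v, r u v → r (l :: u) (l :: v))
    (heven : ∀ u v s, wordParity π u = 0 → wordParity π v = 0 → r (u ++ v ++ s) (v ++ u ++ s))
    (hodd : ∀ u v w s, wordParity π u = 1 → wordParity π v = 1 → wordParity π w = 1 →
      r (u ++ v ++ w ++ s) (w ++ v ++ u ++ s))
    {ε : ZMod 2} {w w' : List L} (h : profile π ε w = profile π ε w') : r w w' := by
  induction w' generalizing ε w with
  | nil =>
    cases w with
    | nil => exact hrefl _
    | cons l w => simp at h
  | cons l w' ih =>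
    -- It is enough to bring `l` to the front of `w` without changing the profile; then `l` is
    -- cancelled and the tails are compared from parity `ε + π l`.
    suffices H : ∃ w₁, profile π ε (l :: w₁) = profile π ε w ∧ r w (l :: w₁) by
      obtain ⟨w₁, h₁, hr⟩ := H
      refine htrans _ _ _ hr (hcons _ _ _ (ih (ε := ε + π l) ?_))
      rw [h, profile_cons, profile_cons] at h₁
      exact (Multiset.cons_inj_right _).1 h₁
    have hl : (l, ε) ∈ profile π ε w := by simp [h]
    obtain ⟨p, s, rfl, hp⟩ := mem_profile π hl
    replace hp : wordParity π p = 0 := by simpa using hp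
    rcases ZMod.two_cases (π l) with hl0 | hl1
    · have hl' : wordParity π [l] = 0 := by simp [hl0]
      refine ⟨p ++ s, ?_, ?_⟩
      · simpa using profile_swap_even π ε hl' hp s
      · simpa using heven p [l] s hp hl'
    -- Here `l` is odd and its prefix `p` is even, so `p` either has only even letters or splits
    -- into two odd blocks.
    rcases forall_even_or_exists_first_odd π p with hev | ⟨p₁, y, p₂, rfl, hp₁, hy⟩
    · cases p with
      | nil => exact ⟨s, rfl, hrefl _⟩
      | cons q p =>
        have hq0 : π q = 0 := hev q (by simp)
        have hq : (q, ε) ∈ profile π ε (l :: w') := by simp [← h]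
        rw [profile_cons, Multiset.mem_cons] at hq
        rcases hq with hq | hq
        · rw [(Prod.mk.inj hq).1, hl1] at hq0
          exact absurd hq0 (by decide)
        obtain ⟨p₂, s₂, hw', hε⟩ := mem_profile π hq
        -- In `l :: w'` the letter `q` with label `ε` comes after the odd letter `l`, so a further
        -- odd letter must restore the parity.
        have hy : ∃ y ∈ w', π y = 1 := by
          by_contra! hcon
          have : wordParity π p₂ = 0 := wordParity_eq_zero_of_forall π fun y hy =>
            (ZMod.two_cases (π y)).resolve_right (hcon y (by simp [hw', hy]))
          rw [this, hl1] at hε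
          simp at hε
        obtain ⟨y, hyw, hy1⟩ := hy
        have hperm := congrArg (Multiset.map Prod.fst) h
        rw [map_fst_profile, map_fst_profile, Multiset.coe_eq_coe] at hperm
        have hperm' : (q :: p ++ s).Perm w' :=
          List.Perm.cons_inv (a := l) (List.perm_middle.symm.trans hperm)
        have hys : y ∈ s := by
          rcases List.mem_append.1 (hperm'.mem_iff.2 hyw) with hy' | hy'
          · rw [hev y hy'] at hy1
            exact absurd hy1 (by decide)
          · exact hy'
        rcases forall_even_or_exists_first_odd π s with hs | ⟨s₁, z, s₂, rfl, hs₁, hz⟩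
        · rw [hs y hys] at hy1
          exact absurd hy1 (by decide)
        -- Closing the block that starts at `l` with the next odd letter `z` makes it even, so it
        -- can be swapped with the even prefix.
        have hv : wordParity π (l :: s₁ ++ [z]) = 0 := by
          simp only [wordParity_append, wordParity_cons, wordParity_nil, hl1, hs₁, hz]
          decide
        refine ⟨s₁ ++ [z] ++ (q :: p) ++ s₂, ?_, ?_⟩
        · simpa using profile_swap_even π ε hv hp s₂
        · simpa using heven (q :: p) (l :: s₁ ++ [z]) s₂ hp hv
    · have hu : wordParity π (p₁ ++ [y]) = 1 := by simp [hp₁, hy]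
      have hv : wordParity π p₂ = 1 := by
        simp only [wordParity_append, wordParity_cons, hp₁, hy] at hp
        revert hp
        generalize wordParity π p₂ = e
        revert e; decide
      have hl' : wordParity π [l] = 1 := by simp [hl1]
      refine ⟨p₂ ++ (p₁ ++ [y]) ++ s, ?_, ?_⟩
      · simpa using profile_swap_odd π ε hl' hv hu s
      · simpa using hodd (p₁ ++ [y]) p₂ [l] s hu hv hl'

end Words

/-! ### Profiles as linearly independent characters -/

section Characters

variable {L : Type*}

/-- The function `∏ z_l ^ a_l * (conj z_l) ^ b_l`, where `a_l` and `b_l` are the multiplicities of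
`(l, 0)` and of `(l, 1)` in `t`. -/
def profileChar (t : Multiset (L × ZMod 2)) : (L → ℂ) →* ℂ where
  toFun z := (t.map fun p => if p.2 = 0 then z p.1 else starRingEnd ℂ (z p.1)).prod
  map_one' := by simp
  map_mul' z z' := by
    rw [← Multiset.prod_map_mul]
    congr 1
    refine Multiset.map_congr rfl fun p _ => ?_
    split_ifs <;> simp

theorem profileChar_apply (t : Multiset (L × ZMod 2)) (z : L → ℂ) :
    profileChar t z = (t.map fun p => if p.2 = 0 then z p.1 else starRingEnd ℂ (z p.1)).prod :=
  rfl

theorem profileChar_mulSingle [DecidableEq L] (t : Multiset (L × ZMod 2)) (l : L) (c : ℂ) :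
    profileChar t (Pi.mulSingle l c) =
      c ^ t.count (l, 0) * starRingEnd ℂ c ^ t.count (l, 1) := by
  induction t using Multiset.induction with
  | empty => simp [profileChar_apply]
  | cons p t ih =>
    obtain ⟨l', e⟩ := p
    rw [profileChar_apply] at ih ⊢
    rw [Multiset.map_cons, Multiset.prod_cons, ih]
    by_cases hl : l' = l
    · subst hl
      rcases ZMod.two_cases e with rfl | rfl
      · simp [pow_succ]; ring
      · simp [pow_succ]; ring
    · have hl' : l ≠ l' := fun h => hl h.symm
      simp [hl, hl']

/-- The value c = 2 determines the sum of the exponents. The value c = exp(i) determines their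
difference modulo 2π, hence exactly, since π is irrational. -/
theorem pow_mul_conj_pow_injective {a b a' b' : ℕ}
    (h : ∀ c : ℂ, c ^ a * starRingEnd ℂ c ^ b = c ^ a' * starRingEnd ℂ c ^ b') :
    a = a' ∧ b = b' := by
  have h1 : a + b = a' + b' := by
    have := h 2
    rw [show starRingEnd ℂ 2 = 2 from Complex.conj_ofNat 2, ← pow_add, ← pow_add] at this
    have h2 : (2 ^ (a + b) : ℕ) = 2 ^ (a' + b') := by exact_mod_cast this
    exact Nat.pow_right_injective le_rfl h2
  have h2 := h (Complex.exp Complex.I)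
  rw [← Complex.exp_conj, Complex.conj_I] at h2
  simp only [← Complex.exp_nat_mul, ← Complex.exp_add] at h2
  obtain ⟨n, hn⟩ := Complex.exp_eq_exp_iff_exists_int.1 h2
  have h3 : ((a : ℝ) - b) = (a' - b') + n * (2 * Real.pi) := by
    have := congrArg Complex.im hn
    simp at this
    linarith
  have hn0 : n = 0 := by
    by_contra hn0
    refine irrational_pi ⟨((a - b) - (a' - b')) / (2 * n), ?_⟩
    have : (n : ℝ) ≠ 0 := by exact_mod_cast hn0
    push_cast
    field_simp
    linarith
  subst hn0
  have h4 : (a : ℤ) - b = a' - b' := by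
    have : (a : ℝ) - b = a' - b' := by simpa using h3
    exact_mod_cast this
  omega

/-- A function equal to c at one letter and to 1 elsewhere isolates the two multiplicities of that
letter. -/
theorem profileChar_injective :
    Function.Injective (profileChar : Multiset (L × ZMod 2) → (L → ℂ) →* ℂ) := by
  classical
  intro t t' h
  have key : ∀ l, t.count (l, 0) = t'.count (l, 0) ∧ t.count (l, 1) = t'.count (l, 1) :=
    fun l => pow_mul_conj_pow_injective fun c => by
      rw [← profileChar_mulSingle, ← profileChar_mulSingle, h]
  ext ⟨l, e⟩
  rcases ZMod.two_cases e with rfl | rfl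
  · exact (key l).1
  · exact (key l).2

theorem linearIndependent_profileChar :
    LinearIndependent ℂ fun t : Multiset (L × ZMod 2) => (profileChar t : (L → ℂ) → ℂ) :=
  (linearIndependent_monoidHom (L → ℂ) ℂ).comp profileChar profileChar_injective

end Characters

/-! ### Monomials modulo equality of profiles -/

section FreeWords

variable (K : Type*) [Field K] {G : Type*}

/-- The monomial of `K⟨X_G⟩` given by a word. -/
def monomial (w : List (ℕ × G)) : FreeGr K G := (w.map (FreeAlgebra.ι K)).prod

@[simp] theorem monomial_nil : monomial K ([] : List (ℕ × G)) = 1 := rfl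

@[simp] theorem monomial_cons (l : ℕ × G) (w : List (ℕ × G)) :
    monomial K (l :: w) = FreeAlgebra.ι K l * monomial K w := by
  simp [monomial]

@[simp] theorem monomial_append (u w : List (ℕ × G)) :
    monomial K (u ++ w) = monomial K u * monomial K w := by
  simp [monomial]

theorem exists_linearCombination_monomial (f : FreeGr K G) :
    ∃ c : List (ℕ × G) →₀ K, Finsupp.linearCombination K (monomial K) c = f := by
  refine Finsupp.mem_span_range_iff_exists_finsupp.1 ?_
  have hmul : ∀ a ∈ Submodule.span K (Set.range (monomial K (G := G))),
      ∀ b ∈ Submodule.span K (Set.range (monomial K (G := G))),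
      a * b ∈ Submodule.span K (Set.range (monomial K (G := G))) := by
    intro a ha b hb
    have := Submodule.mul_mem_mul ha hb
    rw [Submodule.span_mul_span] at this
    refine Submodule.span_mono ?_ this
    rintro _ ⟨_, ⟨u, rfl⟩, _, ⟨w, rfl⟩, rfl⟩
    exact ⟨u ++ w, monomial_append K u w⟩
  induction f using FreeAlgebra.induction with
  | grade0 r =>
    rw [Algebra.algebraMap_eq_smul_one]
    exact Submodule.smul_mem _ _ (Submodule.subset_span ⟨[], rfl⟩)
  | grade1 l => exact Submodule.subset_span ⟨[l], by simp⟩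
  | mul a b ha hb => exact hmul a ha b hb
  | add a b ha hb => exact add_mem ha hb

/-- If a subspace contains the consequences of the commutation of even words and of the reversal of
products of three odd words, then modulo it a monomial depends only on its profile. -/
theorem monomial_sub_monomial_mem (π : ℕ × G → ZMod 2) (W : Submodule K (FreeGr K G))
    (heven : ∀ u p q s : List (ℕ × G), wordParity π p = 0 → wordParity π q = 0 →
      monomial K u * (monomial K p * monomial K q - monomial K q * monomial K p) *
        monomial K s ∈ W)
    (hodd : ∀ u p q r s : List (ℕ × G), wordParity π p = 1 → wordParity π q = 1 →
      wordParity π r = 1 →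
      monomial K u * (monomial K p * monomial K q * monomial K r -
        monomial K r * monomial K q * monomial K p) * monomial K s ∈ W)
    {ε : ZMod 2} {w w' : List (ℕ × G)} (h : profile π ε w = profile π ε w') :
    monomial K w - monomial K w' ∈ W := by
  have key := rel_of_profile_eq π
    (fun w w' => ∀ u, monomial K u * (monomial K w - monomial K w') ∈ W)
    (fun w u => by simp)
    (fun w₁ w₂ w₃ h₁ h₂ u => by
      have := add_mem (h₁ u) (h₂ u)
      rwa [← mul_add, sub_add_sub_cancel] at this)
    (fun l w₁ w₂ h₁ u => by
      have := h₁ (u ++ [l])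
      simpa [mul_sub, mul_assoc] using this)
    (fun p q s hp hq u => by
      have := heven u p q s hp hq
      simpa [mul_sub, sub_mul, mul_assoc] using this)
    (fun p q r s hp hq hr u => by
      have := hodd u p q r s hp hq hr
      simpa [mul_sub, sub_mul, mul_assoc] using this) h []
  simpa using key

/-- A word with a given profile, where there is one. -/
noncomputable def profileWord (π : ℕ × G → ZMod 2) (t : Multiset ((ℕ × G) × ZMod 2)) :
    List (ℕ × G) :=
  Function.invFun (profile π 0) t

theorem profile_profileWord (π : ℕ × G → ZMod 2) (w : List (ℕ × G)) :
    profile π 0 (profileWord π (profile π 0 w)) = profile π 0 w :=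
  Function.invFun_eq ⟨w, rfl⟩

/-- Normal form: each monomial is replaced by the chosen representative of its profile, so
coefficients add up along the fibres of `profile π 0`. -/
theorem linearCombination_sub_mem (π : ℕ × G → ZMod 2) (W : Submodule K (FreeGr K G))
    (h : ∀ w w', profile π 0 w = profile π 0 w' → monomial K w - monomial K w' ∈ W)
    (c : List (ℕ × G) →₀ K) :
    Finsupp.linearCombination K (monomial K) c -
      Finsupp.linearCombination K (fun t => monomial K (profileWord π t))
        (Finsupp.mapDomain (profile π 0) c) ∈ W := by
  rw [Finsupp.linearCombination_mapDomain, Finsupp.linearCombination_apply,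
    Finsupp.linearCombination_apply, Finsupp.sum, Finsupp.sum, ← Finset.sum_sub_distrib]
  refine W.sum_mem fun w _ => ?_
  rw [← smul_sub]
  exact W.smul_mem _ (h _ _ (profile_profileWord π w).symm)

end FreeWords

/-! ### Graded substitutions and the closure of identities and central polynomials -/

section Substitutions

variable (K : Type*) [Field K] {G : Type*} [AddGroup G]

/-- The degree of a word. -/
def wordDegree (w : List (ℕ × G)) : G := (w.map Prod.snd).sum

@[simp] theorem wordDegree_singleton (l : ℕ × G) : wordDegree [l] = l.2 := by
  simp [wordDegree]

theorem monomial_mem_component (w : List (ℕ × G)) :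
    monomial K w ∈ component K (wordDegree w) :=
  Submodule.subset_span ⟨w, rfl, rfl⟩

variable {K}

theorem mul_mem_component {g h : G} {f f' : FreeGr K G} (hf : f ∈ component K g)
    (hf' : f' ∈ component K h) : f * f' ∈ component K (g + h) := by
  have := Submodule.mul_mem_mul hf hf'
  rw [component, component, Submodule.span_mul_span] at this
  refine Submodule.span_mono ?_ this
  rintro _ ⟨_, ⟨u, rfl, rfl⟩, _, ⟨w, rfl, rfl⟩, rfl⟩
  exact ⟨u ++ w, by simp, by simp⟩

/-- Serves both for evaluations in a graded algebra and, with `ℬ = component K`, for building graded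
endomorphisms. -/
theorem lift_mem_of_mem_component {B : Type*} [Ring B] [Algebra K B] (ℬ : G → Submodule K B)
    (hone : 1 ∈ ℬ 0) (hmul : ∀ g h, ∀ b ∈ ℬ g, ∀ b' ∈ ℬ h, b * b' ∈ ℬ (g + h))
    (v : ℕ × G → B) (hv : IsAdmissible ℬ v) {g : G} {f : FreeGr K G}
    (hf : f ∈ component K g) : FreeAlgebra.lift K v f ∈ ℬ g := by
  refine (Submodule.span_le (p := (ℬ g).comap (FreeAlgebra.lift K v).toLinearMap)).2 ?_ hf
  rintro _ ⟨w, rfl, rfl⟩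
  clear hf
  change FreeAlgebra.lift K v (w.map (FreeAlgebra.ι K)).prod ∈ ℬ (w.map Prod.snd).sum
  induction w with
  | nil => simpa using hone
  | cons l w ih =>
    have := hmul l.2 (w.map Prod.snd).sum _ (hv l.1 l.2) _ ih
    simpa using this

theorem one_mem_component_zero : (1 : FreeGr K G) ∈ component K (0 : G) :=
  monomial_mem_component K []

theorem isGradedEnd_lift {v : ℕ × G → FreeGr K G} (hv : IsAdmissible (component K) v) :
    IsGradedEnd (FreeAlgebra.lift K v) := fun _ _ hf =>
  lift_mem_of_mem_component (component K) one_mem_component_zero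
    (fun _ _ _ hb _ hb' => mul_mem_component hb hb') v hv hf

/-- Words may be substituted for variables of the same degrees. -/
theorem exists_gradedEnd (w : ℕ → List (ℕ × G)) :
    ∃ φ : FreeGr K G →ₐ[K] FreeGr K G, IsGradedEnd φ ∧
      ∀ i, φ (x K i (wordDegree (w i))) = monomial K (w i) := by
  classical
  -- For each index only the variable whose degree matches the word is replaced; the others stay
  -- fixed, which keeps the map graded.
  refine ⟨FreeAlgebra.lift K fun p => if p.2 = wordDegree (w p.1) then monomial K (w p.1)
    else FreeAlgebra.ι K p, isGradedEnd_lift fun i g => ?_, fun i => by simp [x]⟩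
  dsimp only
  split_ifs with h
  · rw [h]; exact monomial_mem_component K _
  · simpa using monomial_mem_component K [(i, g)]

variable {B : Type*} [Ring B] [Algebra K B] (ℬ : G → Submodule K B)

theorem isAdmissible_comp (hone : 1 ∈ ℬ 0)
    (hmul : ∀ g h, ∀ b ∈ ℬ g, ∀ b' ∈ ℬ h, b * b' ∈ ℬ (g + h))
    {v : ℕ × G → B} (hv : IsAdmissible ℬ v) {φ : FreeGr K G →ₐ[K] FreeGr K G}
    (hφ : IsGradedEnd φ) :
    ∃ v', IsAdmissible ℬ v' ∧ ∀ f, FreeAlgebra.lift K v (φ f) = FreeAlgebra.lift K v' f := by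
  refine ⟨fun p => FreeAlgebra.lift K v (φ (FreeAlgebra.ι K p)), fun i g => ?_, fun f => ?_⟩
  · refine lift_mem_of_mem_component ℬ hone hmul v hv (hφ g _ ?_)
    simpa using monomial_mem_component K [(i, g)]
  · have : (FreeAlgebra.lift K v).comp φ =
        FreeAlgebra.lift K fun p => FreeAlgebra.lift K v (φ (FreeAlgebra.ι K p)) := by
      ext p; simp
    exact DFunLike.congr_fun this f

/-- The graded identities of a graded algebra contain the `T_G`-ideal generated by any set of graded
identities. -/
theorem tIdealSpan_subset (hone : 1 ∈ ℬ 0)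
    (hmul : ∀ g h, ∀ b ∈ ℬ g, ∀ b' ∈ ℬ h, b * b' ∈ ℬ (g + h)) {S : Set (FreeGr K G)}
    (hS : S ⊆ gradedIdentities ℬ) : (tIdealSpan S : Set (FreeGr K G)) ⊆ gradedIdentities ℬ := by
  intro f hf
  let I : TwoSidedIdeal (FreeGr K G) := TwoSidedIdeal.mk' (gradedIdentities ℬ)
    (fun v _ => by simp)
    (fun {a b} ha hb v hv => by rw [map_add, ha v hv, hb v hv, add_zero])
    (fun {a} ha v hv => by rw [map_neg, ha v hv, neg_zero])
    (fun {a b} hb v hv => by rw [map_mul, hb v hv, mul_zero])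
    (fun {a b} ha v hv => by rw [map_mul, ha v hv, zero_mul])
  have hI : ∀ f, f ∈ I ↔ f ∈ gradedIdentities ℬ := TwoSidedIdeal.mem_mk' _ _ _ _ _ _
  refine (hI f).1 ((TwoSidedIdeal.mem_sInf _).1 hf I ⟨fun φ hφ f hf => ?_, fun f hf =>
    (hI f).2 (hS hf)⟩)
  refine (hI _).2 fun v hv => ?_
  obtain ⟨v', hv', h⟩ := isAdmissible_comp ℬ hone hmul hv hφ
  rw [h]
  exact (hI f).1 hf v' hv'

/-- The graded central polynomials of a graded algebra contain the `T_G`-space generated by any set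
of graded central polynomials. -/
theorem tSpaceSpan_subset (hone : 1 ∈ ℬ 0)
    (hmul : ∀ g h, ∀ b ∈ ℬ g, ∀ b' ∈ ℬ h, b * b' ∈ ℬ (g + h)) {S : Set (FreeGr K G)}
    (hS : S ⊆ gradedCentralPolynomials ℬ) :
    (tSpaceSpan S : Set (FreeGr K G)) ⊆ gradedCentralPolynomials ℬ := by
  intro f hf
  let V : Submodule K (FreeGr K G) :=
    { carrier := gradedCentralPolynomials ℬ
      zero_mem' := fun v _ => by rw [map_zero]; exact zero_mem _
      add_mem' := fun {a b} ha hb v hv => by rw [map_add]; exact add_mem (ha v hv) (hb v hv)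
      smul_mem' := fun r a ha v hv => by
        rw [map_smul]; exact Subalgebra.smul_mem _ (ha v hv) r }
  refine (Submodule.mem_sInf.1 hf V ⟨fun φ hφ f hf v hv => ?_, hS⟩ :)
  obtain ⟨v', hv', h⟩ := isAdmissible_comp ℬ hone hmul hv hφ
  rw [h]
  exact hf v' hv'

end Substitutions

/-! ### Coefficient extraction by independence of characters -/

section Coefficients

variable {L : Type*} (π : L → ZMod 2) (c : L → ℂ)

/-- The product of the weights of the letters of a profile. -/
def profileWeight (t : Multiset (L × ZMod 2)) : ℂ := (t.map fun p => c p.1).prod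

theorem profileWeight_profileConj (t : Multiset (L × ZMod 2)) :
    profileWeight c (profileConj t) = profileWeight c t := by
  simp [profileWeight, profileConj, Multiset.map_map]

variable {c} in
theorem profileWeight_ne_zero (hc : ∀ l, c l ≠ 0) (t : Multiset (L × ZMod 2)) :
    profileWeight c t ≠ 0 :=
  Multiset.prod_ne_zero (by simpa using fun a _ _ => hc a)

/-- The part of parity `δ` of a combination of profiles, with its coefficients weighted. -/
noncomputable def weightedPart (δ : ZMod 2) (C : Multiset (L × ZMod 2) →₀ ℝ) :
    Multiset (L × ZMod 2) →₀ ℂ :=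
  Finsupp.onFinset C.support
    (fun t => if δ = profileParity π t then (C t : ℂ) * profileWeight c t else 0)
    (fun t h => by
      rw [Finsupp.mem_support_iff]
      rintro h0
      simp [h0] at h)

theorem weightedPart_apply (δ : ZMod 2) (C : Multiset (L × ZMod 2) →₀ ℝ)
    (t : Multiset (L × ZMod 2)) : weightedPart π c δ C t =
      if δ = profileParity π t then (C t : ℂ) * profileWeight c t else 0 := rfl

theorem linearCombination_weightedPart (δ : ZMod 2) (C : Multiset (L × ZMod 2) →₀ ℝ)
    (F : Multiset (L × ZMod 2) → (L → ℂ) → ℂ) (z : L → ℂ) :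
    Finsupp.linearCombination ℂ F (weightedPart π c δ C) z = C.sum fun t a =>
      (a : ℂ) * if δ = profileParity π t then profileWeight c t * F t z else 0 := by
  rw [Finsupp.linearCombination_apply, weightedPart,
    Finsupp.onFinset_sum (g := fun t a => a • F t) _ (fun t => zero_smul ℂ (F t)), Finset.sum_apply, Finsupp.sum]
  refine Finset.sum_congr rfl fun t _ => ?_
  split_ifs <;> simp [mul_assoc]

variable {c}

theorem coeff_eq_zero (hc : ∀ l, c l ≠ 0) {δ : ZMod 2} {C : Multiset (L × ZMod 2) →₀ ℝ}
    (h : ∀ z : L → ℂ, (C.sum fun t a => (a : ℂ) *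
      if δ = profileParity π t then profileWeight c t * profileChar t z else 0) = 0)
    {t : Multiset (L × ZMod 2)} (ht : δ = profileParity π t) : C t = 0 := by
  have h0 : weightedPart π c δ C = 0 := by
    refine linearIndependent_iff.1 linearIndependent_profileChar _ (funext fun z => ?_)
    rw [linearCombination_weightedPart, h]
    rfl
  have := DFunLike.congr_fun h0 t
  rw [weightedPart_apply, if_pos ht] at this
  simpa [profileWeight_ne_zero hc] using this

/-- The right-hand sum is the left-hand one with its coefficients pushed forward along
`profileConj`. By independence the two coefficient families agree, and the weights cancel because
conjugation preserves them. -/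
theorem coeff_profileConj (hc : ∀ l, c l ≠ 0) {δ : ZMod 2} {C : Multiset (L × ZMod 2) →₀ ℝ}
    (h : ∀ z : L → ℂ, (C.sum fun t a => (a : ℂ) *
        if δ = profileParity π t then profileWeight c t * profileChar t z else 0) =
      C.sum fun t a => (a : ℂ) *
        if δ = profileParity π t then profileWeight c t * profileChar (profileConj t) z else 0)
    {t : Multiset (L × ZMod 2)} (ht : δ = profileParity π t) : C (profileConj t) = C t := by
  have hD : weightedPart π c δ C = Finsupp.mapDomain profileConj (weightedPart π c δ C) := by
    refine linearIndependent_profileChar.finsuppLinearCombination_injective (funext fun z => ?_)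
    rw [Finsupp.linearCombination_mapDomain, linearCombination_weightedPart,
      linearCombination_weightedPart, h]
    rfl
  have := DFunLike.congr_fun hD (profileConj t)
  rw [Finsupp.mapDomain_apply
      (Function.Involutive.injective (f := profileConj) profileConj_profileConj),
    weightedPart_apply, weightedPart_apply, profileParity_profileConj, if_pos ht, if_pos ht,
    profileWeight_profileConj] at this
  exact_mod_cast mul_right_cancel₀ (profileWeight_ne_zero hc t) this

end Coefficients

/-! ### Action of homogeneous matrices on the two eigenlines -/

section Evaluation

open Matrix

/-- The parity of an element of `ℤ/4`. -/
def parity : ZMod 4 →+* ZMod 2 := ZMod.castHom (by norm_num) (ZMod 2)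

/-- The scalars `1, ω, i, iω`. -/
noncomputable def weight : ZMod 4 → ℂ := (![1, om, Complex.I, Complex.I * om] : Fin 4 → ℂ)

theorem weight_ne_zero (g : ZMod 4) : weight g ≠ 0 := by
  fin_cases g
  · exact one_ne_zero
  · exact om_ne_zero
  · exact Complex.I_ne_zero
  · exact mul_ne_zero Complex.I_ne_zero om_ne_zero

/-- The common left eigenvectors of the matrices of even degree. -/
noncomputable def rowVec (ε : ZMod 2) : Fin 2 → ℂ :=
  ![1, if ε = 0 then -Complex.I else Complex.I]

/-- The basis dual to that of the left eigenvectors. -/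
noncomputable def colVec (δ : ZMod 2) : Fin 2 → ℂ :=
  ![1 / 2, if δ = 0 then Complex.I / 2 else -Complex.I / 2]

theorem rowVec_dotProduct_colVec (ε δ : ZMod 2) :
    rowVec ε ⬝ᵥ colVec δ = if δ = ε then 1 else 0 := by
  have hI := Complex.I_mul_I
  rcases ZMod.two_cases ε with rfl | rfl <;> rcases ZMod.two_cases δ with rfl | rfl <;>
    simp [rowVec, colVec]
  · linear_combination (-1 / 2) * hI
  · linear_combination (1 / 2) * hI
  · linear_combination (1 / 2) * hI
  · linear_combination (-1 / 2) * hI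

/-- A coefficient of a matrix in the bases `rowVec` and `colVec`. -/
noncomputable def entry (ε δ : ZMod 2) : M2C →ₗ[ℝ] ℂ where
  toFun M := rowVec ε ᵥ* M ⬝ᵥ colVec δ
  map_add' M N := by rw [vecMul_add, add_dotProduct]
  map_smul' a M := by rw [vecMul_smul, smul_dotProduct]; rfl

theorem entry_apply (ε δ : ZMod 2) (M : M2C) : entry ε δ M = rowVec ε ᵥ* M ⬝ᵥ colVec δ := rfl

theorem entry_smul_one (ε δ : ZMod 2) (s : ℂ) :
    entry ε δ (s • (1 : M2C)) = if δ = ε then s else 0 := by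
  rw [entry_apply, vecMul_smul, vecMul_one, smul_dotProduct, rowVec_dotProduct_colVec]
  split_ifs <;> simp

/-- Divided by `weight g`, the component is a plane of real matrices, and `rowVec 1` is the
conjugate of `rowVec 0`; so the multiplier on one vector is free and that on the other is its
conjugate. -/
theorem exists_mem_m2cZ4_vecMul (g : ZMod 4) (z : ℂ) : ∃ M ∈ m2cZ4 g, ∀ ε,
    rowVec ε ᵥ* M =
      (weight g * if ε = 0 then z else starRingEnd ℂ z) • rowVec (ε + parity g) := by
  have hI := Complex.I_mul_I
  have hz := Complex.re_add_im z
  have hz' : starRingEnd ℂ z = z.re - z.im * Complex.I := by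
    apply Complex.ext <;> simp
  have p0 : parity 0 = 0 := by decide
  have p1 : parity 1 = 1 := by decide
  have p2 : parity 2 = 0 := by decide
  have p3 : parity 3 = 1 := by decide
  have w0 : weight 0 = 1 := rfl
  have w1 : weight 1 = om := rfl
  have w2 : weight 2 = Complex.I := rfl
  have w3 : weight 3 = Complex.I * om := rfl
  have h11 : (1 + 1 : ZMod 2) = 0 := rfl
  rw [hz']
  generalize z.re = p at *
  generalize z.im = q at *
  subst hz
  have d : ∀ i : ZMod 4, i = 0 ∨ i = 1 ∨ i = 2 ∨ i = 3 := by decide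
  rcases d g with rfl | rfl | rfl | rfl
  · refine ⟨_, (mem_m2cZ4_zero _).2 ⟨p, q, rfl⟩, fun ε => ?_⟩
    rw [w0, p0]
    rcases ZMod.two_cases ε with rfl | rfl <;> ext i <;> fin_cases i <;>
      simp [rowVec]
    all_goals first | ring1 | linear_combination (-q : ℂ) * hI | linear_combination (q : ℂ) * hI
  -- The sign of `q` makes the multiplier on `rowVec 0` equal to z rather than its conjugate, as in
  -- the even case.
  · refine ⟨_, (mem_m2cZ4_one _).2 ⟨p, -q, rfl⟩, fun ε => ?_⟩
    rw [w1, p1]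
    rcases ZMod.two_cases ε with rfl | rfl <;> ext i <;> fin_cases i <;>
      simp [rowVec, h11]
    all_goals first | ring1 | linear_combination (-q : ℂ) * om * hI
  · refine ⟨_, (mem_m2cZ4_two _).2 ⟨p, q, rfl⟩, fun ε => ?_⟩
    rw [w2, p2]
    rcases ZMod.two_cases ε with rfl | rfl <;> ext i <;> fin_cases i <;>
      simp [rowVec]
    all_goals first | ring1 | linear_combination (-q : ℂ) * Complex.I * hI |
      linear_combination (q : ℂ) * Complex.I * hI
  · refine ⟨_, (mem_m2cZ4_three _).2 ⟨p, -q, rfl⟩, fun ε => ?_⟩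
    rw [w3, p3]
    rcases ZMod.two_cases ε with rfl | rfl <;> ext i <;> fin_cases i <;>
      simp [rowVec, h11]
    all_goals first | ring1 | linear_combination (-q : ℂ) * (Complex.I * om) * hI

variable {G : Type*}

/-- The letters act one after another from the right, and the parity of the prefix records which
eigenvector the next letter meets. -/
theorem vecMul_lift_monomial {π : ℕ × G → ZMod 2} {c z : ℕ × G → ℂ} {v : ℕ × G → M2C}
    (hv : ∀ l ε, rowVec ε ᵥ* v l =
      (c l * if ε = 0 then z l else starRingEnd ℂ (z l)) • rowVec (ε + π l))
    (ε : ZMod 2) (w : List (ℕ × G)) :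
    rowVec ε ᵥ* FreeAlgebra.lift ℝ v (monomial ℝ w) =
      (profileWeight c (profile π ε w) * profileChar (profile π ε w) z) •
        rowVec (ε + wordParity π w) := by
  induction w generalizing ε with
  | nil => simp [profileWeight, profileChar_apply]
  | cons l w ih =>
    rw [monomial_cons, map_mul, FreeAlgebra.lift_ι_apply, ← vecMul_vecMul, hv, smul_vecMul, ih,
      smul_smul, wordParity_cons, add_assoc]
    congr 1
    simp only [profileWeight, profileChar_apply, profile_cons, Multiset.map_cons,
      Multiset.prod_cons]
    ring

theorem entry_lift_linearCombination {π : ℕ × G → ZMod 2} {c z : ℕ × G → ℂ} {v : ℕ × G → M2C}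
    (hv : ∀ l ε, rowVec ε ᵥ* v l =
      (c l * if ε = 0 then z l else starRingEnd ℂ (z l)) • rowVec (ε + π l))
    (ε δ : ZMod 2) (a : List (ℕ × G) →₀ ℝ) :
    entry ε δ (FreeAlgebra.lift ℝ v (Finsupp.linearCombination ℝ (monomial ℝ) a)) =
      a.sum fun w r => (r : ℂ) * if δ = ε + wordParity π w then
        profileWeight c (profile π ε w) * profileChar (profile π ε w) z else 0 := by
  rw [Finsupp.linearCombination_apply, map_finsuppSum, map_finsuppSum]
  refine Finset.sum_congr rfl fun w _ => ?_
  dsimp only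
  rw [map_smul, map_smul, entry_apply, vecMul_lift_monomial hv, smul_dotProduct,
    rowVec_dotProduct_colVec]
  simp

theorem entry_zero_lift_linearCombination {π : ℕ × G → ZMod 2} {c z : ℕ × G → ℂ}
    {v : ℕ × G → M2C}
    (hv : ∀ l ε, rowVec ε ᵥ* v l =
      (c l * if ε = 0 then z l else starRingEnd ℂ (z l)) • rowVec (ε + π l))
    (δ : ZMod 2) (a : List (ℕ × G) →₀ ℝ) :
    entry 0 δ (FreeAlgebra.lift ℝ v (Finsupp.linearCombination ℝ (monomial ℝ) a)) =
      (Finsupp.mapDomain (profile π 0) a).sum fun t r => (r : ℂ) *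
        if δ = profileParity π t then profileWeight c t * profileChar t z else 0 := by
  rw [entry_lift_linearCombination hv, Finsupp.sum_mapDomain_index (by simp)
    (by intros; push_cast; ring)]
  simp only [profileParity_profile, zero_add]

theorem entry_one_lift_linearCombination {π : ℕ × G → ZMod 2} {c z : ℕ × G → ℂ}
    {v : ℕ × G → M2C}
    (hv : ∀ l ε, rowVec ε ᵥ* v l =
      (c l * if ε = 0 then z l else starRingEnd ℂ (z l)) • rowVec (ε + π l))
    (δ : ZMod 2) (a : List (ℕ × G) →₀ ℝ) :
    entry 1 (δ + 1) (FreeAlgebra.lift ℝ v (Finsupp.linearCombination ℝ (monomial ℝ) a)) =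
      (Finsupp.mapDomain (profile π 0) a).sum fun t r => (r : ℂ) *
        if δ = profileParity π t then
          profileWeight c t * profileChar (profileConj t) z else 0 := by
  rw [entry_lift_linearCombination hv, Finsupp.sum_mapDomain_index (by simp)
    (by intros; push_cast; ring)]
  have h : ∀ w : List (ℕ × G), profile π 1 w = profileConj (profile π 0 w) := fun w => by
    rw [← profile_add_one, zero_add]
  simp only [profileParity_profile, h, profileWeight_profileConj, add_comm (1 : ZMod 2),
    add_left_inj]

end Evaluation
-- Invariance under graded isomorphisms
section Transfer

variable {K : Type*} [Field K] {G : Type*} {A B : Type*} [Ring A] [Algebra K A]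
  [Ring B] [Algebra K B] {𝒜 : G → Submodule K A} {ℬ : G → Submodule K B}

theorem apply_lift (φ : A ≃ₐ[K] B) (v : ℕ × G → A) (f : FreeGr K G) :
    φ (FreeAlgebra.lift K v f) = FreeAlgebra.lift K (φ ∘ v) f := by
  have : (φ : A →ₐ[K] B).comp (FreeAlgebra.lift K v) = FreeAlgebra.lift K (φ ∘ v) := by
    ext p; simp
  exact DFunLike.congr_fun this f

theorem gradedIdentities_anti (φ : A ≃ₐ[K] B) (h : ∀ g, ∀ b ∈ 𝒜 g, φ b ∈ ℬ g) :
    gradedIdentities ℬ ⊆ gradedIdentities 𝒜 := fun f hf v hv => by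
  have := hf (φ ∘ v) fun i g => h g _ (hv i g)
  rwa [← apply_lift, EmbeddingLike.map_eq_zero_iff] at this

theorem gradedCentralPolynomials_anti (φ : A ≃ₐ[K] B) (h : ∀ g, ∀ b ∈ 𝒜 g, φ b ∈ ℬ g) :
    gradedCentralPolynomials ℬ ⊆ gradedCentralPolynomials 𝒜 := fun f hf v hv => by
  have := hf (φ ∘ v) fun i g => h g _ (hv i g)
  rw [← apply_lift, Subalgebra.mem_center_iff] at this
  refine Subalgebra.mem_center_iff.2 fun b => φ.injective ?_
  rw [map_mul, map_mul, this]

theorem gradedIdentities_eq_of_map_eq (φ : A ≃ₐ[K] B)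
    (h : ∀ g, (𝒜 g).map φ.toLinearMap = ℬ g) : gradedIdentities 𝒜 = gradedIdentities ℬ := by
  refine Set.Subset.antisymm (gradedIdentities_anti φ.symm fun g b hb => ?_)
    (gradedIdentities_anti φ fun g b hb => ?_)
  · rw [← h] at hb
    obtain ⟨b', hb', rfl⟩ := hb
    simpa using hb'
  · rw [← h]
    exact ⟨b, hb, rfl⟩

theorem gradedCentralPolynomials_eq_of_map_eq (φ : A ≃ₐ[K] B)
    (h : ∀ g, (𝒜 g).map φ.toLinearMap = ℬ g) :
    gradedCentralPolynomials 𝒜 = gradedCentralPolynomials ℬ := by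
  refine Set.Subset.antisymm (gradedCentralPolynomials_anti φ.symm fun g b hb => ?_)
    (gradedCentralPolynomials_anti φ fun g b hb => ?_)
  · rw [← h] at hb
    obtain ⟨b', hb', rfl⟩ := hb
    simpa using hb'
  · rw [← h]
    exact ⟨b, hb, rfl⟩

end Transfer

/-! ### The listed polynomials checked on matrices -/

section Components

open Matrix

theorem exists_of_mem_m2cZ4_even {g : ZMod 4} (hg : parity g = 0) {M : M2C} (hM : M ∈ m2cZ4 g) :
    ∃ s t : ℂ, M = !![s, t; -t, s] := by
  have d : ∀ i : ZMod 4, parity i = 0 → i = 0 ∨ i = 2 := by decide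
  rcases d g hg with rfl | rfl
  · obtain ⟨p, q, rfl⟩ := (mem_m2cZ4_zero _).1 hM
    exact ⟨_, _, rfl⟩
  · obtain ⟨p, q, rfl⟩ := (mem_m2cZ4_two _).1 hM
    exact ⟨_, _, rfl⟩

theorem exists_of_mem_m2cZ4_odd {g : ZMod 4} (hg : parity g = 1) {M : M2C} (hM : M ∈ m2cZ4 g) :
    ∃ s t : ℂ, M = !![s, t; t, -s] := by
  have d : ∀ i : ZMod 4, parity i = 1 → i = 1 ∨ i = 3 := by decide
  rcases d g hg with rfl | rfl
  · obtain ⟨p, q, rfl⟩ := (mem_m2cZ4_one _).1 hM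
    exact ⟨_, _, rfl⟩
  · obtain ⟨p, q, rfl⟩ := (mem_m2cZ4_three _).1 hM
    exact ⟨_, _, rfl⟩

theorem mul_comm_of_even {g h : ZMod 4} (hg : parity g = 0) (hh : parity h = 0) {M N : M2C}
    (hM : M ∈ m2cZ4 g) (hN : N ∈ m2cZ4 h) : M * N = N * M := by
  obtain ⟨s, t, rfl⟩ := exists_of_mem_m2cZ4_even hg hM
  obtain ⟨s', t', rfl⟩ := exists_of_mem_m2cZ4_even hh hN
  ext i j
  fin_cases i <;> fin_cases j <;> simp <;> ring

/-- In the eigenbasis odd matrices are antidiagonal, and each entry of a product of three takes its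
outer factors from the same position. -/
theorem mul_reverse_of_odd {g h k : ZMod 4} (hg : parity g = 1) (hh : parity h = 1)
    (hk : parity k = 1) {M N P : M2C} (hM : M ∈ m2cZ4 g) (hN : N ∈ m2cZ4 h) (hP : P ∈ m2cZ4 k) :
    M * N * P = P * N * M := by
  obtain ⟨s, t, rfl⟩ := exists_of_mem_m2cZ4_odd hg hM
  obtain ⟨s', t', rfl⟩ := exists_of_mem_m2cZ4_odd hh hN
  obtain ⟨s'', t'', rfl⟩ := exists_of_mem_m2cZ4_odd hk hP
  ext i j
  fin_cases i <;> fin_cases j <;> simp <;> ring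

/-- Polarization of (sA + tB)² = (s² + t²)I. -/
theorem add_mem_center_of_odd {g h : ZMod 4} (hg : parity g = 1) (hh : parity h = 1) {M N : M2C}
    (hM : M ∈ m2cZ4 g) (hN : N ∈ m2cZ4 h) : M * N + N * M ∈ Subalgebra.center ℝ M2C := by
  obtain ⟨s, t, rfl⟩ := exists_of_mem_m2cZ4_odd hg hM
  obtain ⟨s', t', rfl⟩ := exists_of_mem_m2cZ4_odd hh hN
  have : !![s, t; t, -s] * !![s', t'; t', -s'] + !![s', t'; t', -s'] * !![s, t; t, -s] =
      (2 * (s * s' + t * t')) • (1 : M2C) := by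
    ext i j
    fin_cases i <;> fin_cases j <;> simp <;> ring
  rw [this]
  exact Subalgebra.mem_center_iff.2 fun b => by simp

theorem exists_smul_one_of_mem_center {M : M2C} (hM : M ∈ Subalgebra.center ℝ M2C) :
    ∃ s : ℂ, M = s • (1 : M2C) := by
  have h : M ∈ Set.center M2C := by
    rw [Semigroup.mem_center_iff]
    exact Subalgebra.mem_center_iff.1 hM
  rw [Matrix.center_eq_range] at h
  obtain ⟨s, rfl⟩ := h
  exact ⟨s, by ext i j; fin_cases i <;> fin_cases j <;> simp⟩

end Components

/-! ### The two bases, for the model grading with renamed degrees -/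

section Bases

variable {G : Type*} [AddGroup G] (α : G ≃+ ZMod 4)

/-- The grading `m2cZ4`, with its degrees renamed. -/
noncomputable abbrev m2cZ4Comp (g : G) : Submodule ℝ M2C := m2cZ4 (α g)

/-- The parity of a variable. -/
def varParity (l : ℕ × G) : ZMod 2 := parity (α l.2)

theorem parity_wordDegree (w : List (ℕ × G)) :
    parity (α (wordDegree w)) = wordParity (varParity α) w := by
  simp only [wordDegree, wordParity, map_list_sum, List.map_map]
  rfl

theorem one_mem_m2cZ4Comp : (1 : M2C) ∈ m2cZ4Comp α 0 := by
  rw [m2cZ4Comp, map_zero]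
  exact SetLike.GradedOne.one_mem

theorem mul_mem_m2cZ4Comp (g h : G) (M : M2C) (hM : M ∈ m2cZ4Comp α g) (N : M2C)
    (hN : N ∈ m2cZ4Comp α h) : M * N ∈ m2cZ4Comp α (g + h) := by
  rw [m2cZ4Comp, map_add]
  exact m2cZ4_mul _ _ M N hM hN

theorem exists_admissible (z : ℕ × G → ℂ) : ∃ v : ℕ × G → M2C, IsAdmissible (m2cZ4Comp α) v ∧
    ∀ l ε, Matrix.vecMul (rowVec ε) (v l) =
      (weight (α l.2) * if ε = 0 then z l else starRingEnd ℂ (z l)) •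
        rowVec (ε + varParity α l) := by
  choose v hv using fun l : ℕ × G => exists_mem_m2cZ4_vecMul (α l.2) (z l)
  exact ⟨v, fun i g => (hv (i, g)).1, fun l => (hv l).2⟩

variable {α} in
theorem mapDomain_profile_eq_zero {a : List (ℕ × G) →₀ ℝ}
    (h : Finsupp.linearCombination ℝ (monomial ℝ) a ∈ gradedIdentities (m2cZ4Comp α)) :
    Finsupp.mapDomain (profile (varParity α) 0) a = 0 := by
  ext t
  refine coeff_eq_zero (varParity α) (c := fun l => weight (α l.2))
    (fun l => weight_ne_zero _) (fun z => ?_) rfl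
  obtain ⟨v, hv, hz⟩ := exists_admissible α z
  rw [← entry_zero_lift_linearCombination hz, h v hv, map_zero]

variable {α} in
-- Odd words contribute exactly to the entry between different eigenlines, which vanishes for a
-- scalar matrix.
theorem mapDomain_profile_eq_zero_of_odd {a : List (ℕ × G) →₀ ℝ}
    (h : Finsupp.linearCombination ℝ (monomial ℝ) a ∈ gradedCentralPolynomials (m2cZ4Comp α))
    {t : Multiset ((ℕ × G) × ZMod 2)} (ht : 1 = profileParity (varParity α) t) :
    Finsupp.mapDomain (profile (varParity α) 0) a t = 0 := by
  refine coeff_eq_zero (varParity α) (c := fun l => weight (α l.2))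
    (fun l => weight_ne_zero _) (fun z => ?_) ht
  obtain ⟨v, hv, hz⟩ := exists_admissible α z
  obtain ⟨s, hs⟩ := exists_smul_one_of_mem_center (h v hv)
  rw [← entry_zero_lift_linearCombination hz, hs, entry_smul_one, if_neg (by decide)]

variable {α} in
-- The two diagonal entries of a scalar matrix agree, and reading from the second eigenvector
-- conjugates every profile. Odd profiles have coefficient zero anyway.
theorem mapDomain_profile_profileConj {a : List (ℕ × G) →₀ ℝ}
    (h : Finsupp.linearCombination ℝ (monomial ℝ) a ∈ gradedCentralPolynomials (m2cZ4Comp α))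
    (t : Multiset ((ℕ × G) × ZMod 2)) :
    Finsupp.mapDomain (profile (varParity α) 0) a (profileConj t) =
      Finsupp.mapDomain (profile (varParity α) 0) a t := by
  rcases ZMod.two_cases (profileParity (varParity α) t) with ht | ht
  · refine coeff_profileConj (varParity α) (c := fun l => weight (α l.2))
      (fun l => weight_ne_zero _) (fun z => ?_) ht.symm
    obtain ⟨v, hv, hz⟩ := exists_admissible α z
    obtain ⟨s, hs⟩ := exists_smul_one_of_mem_center (h v hv)
    rw [← entry_zero_lift_linearCombination hz, ← entry_one_lift_linearCombination hz, hs,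
      entry_smul_one, entry_smul_one]
    simp
  · rw [mapDomain_profile_eq_zero_of_odd h ht.symm,
      mapDomain_profile_eq_zero_of_odd h (by rw [profileParity_profileConj, ht])]

theorem isBasisOfIdentities_m2cZ4Comp {E O : Set G}
    (hE : ∀ g, g ∈ E ↔ parity (α g) = 0) (hO : ∀ g, g ∈ O ↔ parity (α g) = 1) :
    IsBasisOfIdentities (m2cZ4Comp α)
      ({f | ∃ k₁ ∈ E, ∃ k₂ ∈ E, f = x ℝ 1 k₁ * x ℝ 2 k₂ - x ℝ 2 k₂ * x ℝ 1 k₁} ∪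
       {f | ∃ h₁ ∈ O, ∃ h₂ ∈ O, ∃ h₃ ∈ O,
          f = x ℝ 1 h₁ * x ℝ 2 h₂ * x ℝ 3 h₃ - x ℝ 3 h₃ * x ℝ 2 h₂ * x ℝ 1 h₁}) := by
  refine Set.Subset.antisymm (fun f hf => ?_)
    (tIdealSpan_subset _ (one_mem_m2cZ4Comp α) (mul_mem_m2cZ4Comp α) ?_)
  · refine (TwoSidedIdeal.mem_sInf _).2 fun I hI => ?_
    obtain ⟨hT, hS⟩ := hI
    let W : Submodule ℝ (FreeGr ℝ G) :=
      { carrier := I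
        zero_mem' := I.zero_mem
        add_mem' := I.add_mem
        smul_mem' := fun r b hb => by
          rw [Algebra.smul_def]
          exact I.mul_mem_left _ _ hb }
    have hW : ∀ w w', profile (varParity α) 0 w = profile (varParity α) 0 w' →
        monomial ℝ w - monomial ℝ w' ∈ W := by
      refine fun w w' h => monomial_sub_monomial_mem ℝ _ W ?_ ?_ h
      · intro u p q s hp hq
        -- The leading `[]` fills index 0, since the variables of the basis are numbered from 1.
        obtain ⟨φ, hφ, h⟩ := exists_gradedEnd (K := ℝ) fun i => [[], p, q].getD i []
        have h1 : φ (x ℝ 1 (wordDegree p)) = monomial ℝ p := h 1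
        have h2 : φ (x ℝ 2 (wordDegree q)) = monomial ℝ q := h 2
        rw [← parity_wordDegree, ← hE] at hp hq
        have := hT φ hφ _ (hS _ (Or.inl ⟨_, hp, _, hq, rfl⟩))
        simp only [map_sub, map_mul, h1, h2] at this
        exact I.mul_mem_right _ _ (I.mul_mem_left _ _ this)
      · intro u p q r s hp hq hr
        obtain ⟨φ, hφ, h⟩ := exists_gradedEnd (K := ℝ) fun i => [[], p, q, r].getD i []
        have h1 : φ (x ℝ 1 (wordDegree p)) = monomial ℝ p := h 1
        have h2 : φ (x ℝ 2 (wordDegree q)) = monomial ℝ q := h 2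
        have h3 : φ (x ℝ 3 (wordDegree r)) = monomial ℝ r := h 3
        rw [← parity_wordDegree, ← hO] at hp hq hr
        have := hT φ hφ _ (hS _ (Or.inr ⟨_, hp, _, hq, _, hr, rfl⟩))
        simp only [map_sub, map_mul, h1, h2, h3] at this
        exact I.mul_mem_right _ _ (I.mul_mem_left _ _ this)
    obtain ⟨a, rfl⟩ := exists_linearCombination_monomial ℝ f
    have := linearCombination_sub_mem ℝ (varParity α) W hW a
    rw [mapDomain_profile_eq_zero hf, map_zero, sub_zero] at this
    exact this
  · rintro f (⟨k₁, h₁, k₂, h₂, rfl⟩ | ⟨k₁, h₁, k₂, h₂, k₃, h₃, rfl⟩) v hv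
    · simp only [x, map_sub, map_mul, FreeAlgebra.lift_ι_apply]
      rw [mul_comm_of_even ((hE _).1 h₁) ((hE _).1 h₂) (hv 1 k₁) (hv 2 k₂), sub_self]
    · simp only [x, map_sub, map_mul, FreeAlgebra.lift_ι_apply]
      rw [mul_reverse_of_odd ((hO _).1 h₁) ((hO _).1 h₂) ((hO _).1 h₃) (hv 1 k₁) (hv 2 k₂)
        (hv 3 k₃), sub_self]

theorem isBasisOfCentralPolynomials_m2cZ4Comp {E O : Set G}
    (hE : ∀ g, g ∈ E ↔ parity (α g) = 0) (hO : ∀ g, g ∈ O ↔ parity (α g) = 1) :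
    IsBasisOfCentralPolynomials (m2cZ4Comp α)
      ({1} ∪
       {f | ∃ h₁ ∈ O, ∃ h₂ ∈ O, f = x ℝ 1 h₁ * x ℝ 2 h₂ + x ℝ 2 h₂ * x ℝ 1 h₁} ∪
       {f | ∃ g₁ g₄ : G, ∃ k₂ ∈ E, ∃ k₃ ∈ E,
          f = x ℝ 1 g₁ * (x ℝ 2 k₂ * x ℝ 3 k₃ - x ℝ 3 k₃ * x ℝ 2 k₂) * x ℝ 4 g₄} ∪
       {f | ∃ g₁ g₅ : G, ∃ h₂ ∈ O, ∃ h₃ ∈ O, ∃ h₄ ∈ O,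
          f = x ℝ 1 g₁ *
            (x ℝ 2 h₂ * x ℝ 3 h₃ * x ℝ 4 h₄ - x ℝ 4 h₄ * x ℝ 3 h₃ * x ℝ 2 h₂) *
            x ℝ 5 g₅}) := by
  refine Set.Subset.antisymm (fun f hf => ?_)
    (tSpaceSpan_subset _ (one_mem_m2cZ4Comp α) (mul_mem_m2cZ4Comp α) ?_)
  · refine Submodule.mem_sInf.2 fun V hV => ?_
    obtain ⟨hT, hS⟩ := hV
    have hV : ∀ w w', profile (varParity α) 0 w = profile (varParity α) 0 w' →
        monomial ℝ w - monomial ℝ w' ∈ V := by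
      refine fun w w' h => monomial_sub_monomial_mem ℝ _ V ?_ ?_ h
      -- A `T_G`-space is not closed under multiplication, so the outer words `u` and `s` are
      -- substituted for the outer variables of the generator; an empty word amounts to substituting
      -- 1.
      · intro u p q s hp hq
        obtain ⟨φ, hφ, h⟩ := exists_gradedEnd (K := ℝ) fun i => [[], u, p, q, s].getD i []
        have h1 : φ (x ℝ 1 (wordDegree u)) = monomial ℝ u := h 1
        have h2 : φ (x ℝ 2 (wordDegree p)) = monomial ℝ p := h 2
        have h3 : φ (x ℝ 3 (wordDegree q)) = monomial ℝ q := h 3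
        have h4 : φ (x ℝ 4 (wordDegree s)) = monomial ℝ s := h 4
        rw [← parity_wordDegree, ← hE] at hp hq
        have := hT φ hφ _ (hS _ (Or.inl (Or.inr ⟨wordDegree u, wordDegree s, _, hp, _, hq, rfl⟩)))
        simpa only [map_sub, map_mul, h1, h2, h3, h4] using this
      · intro u p q r s hp hq hr
        obtain ⟨φ, hφ, h⟩ := exists_gradedEnd (K := ℝ) fun i => [[], u, p, q, r, s].getD i []
        have h1 : φ (x ℝ 1 (wordDegree u)) = monomial ℝ u := h 1
        have h2 : φ (x ℝ 2 (wordDegree p)) = monomial ℝ p := h 2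
        have h3 : φ (x ℝ 3 (wordDegree q)) = monomial ℝ q := h 3
        have h4 : φ (x ℝ 4 (wordDegree r)) = monomial ℝ r := h 4
        have h5 : φ (x ℝ 5 (wordDegree s)) = monomial ℝ s := h 5
        rw [← parity_wordDegree, ← hO] at hp hq hr
        have := hT φ hφ _ (hS _ (Or.inr ⟨wordDegree u, wordDegree s, _, hp, _, hq, _, hr, rfl⟩))
        simpa only [map_sub, map_mul, h1, h2, h3, h4, h5] using this
    have hanti : ∀ p q : List (ℕ × G), wordParity (varParity α) p = 1 →
        wordParity (varParity α) q = 1 →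
        monomial ℝ p * monomial ℝ q + monomial ℝ q * monomial ℝ p ∈ V := by
      intro p q hp hq
      obtain ⟨φ, hφ, h⟩ := exists_gradedEnd (K := ℝ) fun i => [[], p, q].getD i []
      have h1 : φ (x ℝ 1 (wordDegree p)) = monomial ℝ p := h 1
      have h2 : φ (x ℝ 2 (wordDegree q)) = monomial ℝ q := h 2
      rw [← parity_wordDegree, ← hO] at hp hq
      have := hT φ hφ _ (hS _ (Or.inl (Or.inl (Or.inr ⟨_, hp, _, hq, rfl⟩))))
      simpa only [map_add, map_mul, h1, h2] using this
    have hone : (1 : FreeGr ℝ G) ∈ V := hS _ (Or.inl (Or.inl (Or.inl rfl)))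
    obtain ⟨a, rfl⟩ := exists_linearCombination_monomial ℝ f
    have hred := linearCombination_sub_mem ℝ (varParity α) V hV a
    suffices H : Finsupp.linearCombination ℝ
        (fun t => monomial ℝ (profileWord (varParity α) t))
        (Finsupp.mapDomain (profile (varParity α) 0) a) ∈ V by
      simpa using add_mem hred H
    have hodd := fun t => mapDomain_profile_eq_zero_of_odd hf (t := t)
    have hconj := mapDomain_profile_profileConj hf
    -- Not every multiset is the profile of a word; outside the range `profileWord` is meaningless.
    have hrange : ∀ t, Finsupp.mapDomain (profile (varParity α) 0) a t ≠ 0 →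
        ∃ w, profile (varParity α) 0 w = t := fun t ht => by
      by_contra hcon
      exact ht (Finsupp.mapDomain_of_notMem_range _ _ hcon)
    generalize Finsupp.mapDomain (profile (varParity α) 0) a = C at *
    have hpair : ∀ t, C t ≠ 0 → monomial ℝ (profileWord (varParity α) t) +
        monomial ℝ (profileWord (varParity α) (profileConj t)) ∈ V := by
      intro t ht
      obtain ⟨w, rfl⟩ := hrange t ht
      have hw : wordParity (varParity α) w = 0 :=
        (ZMod.two_cases _).resolve_right fun h =>
          ht (hodd _ (by rw [profileParity_profile, h]))
      have hrep : ∀ w, monomial ℝ (profileWord (varParity α) (profile (varParity α) 0 w)) -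
          monomial ℝ w ∈ V := fun w => hV _ _ (profile_profileWord _ w)
      rcases forall_even_or_exists_first_odd (varParity α) w with hev | ⟨p, y, s, rfl, hp, hy⟩
      · cases w with
        -- The empty profile is its own conjugate and is represented by the constant 1.
        | nil =>
          have h1 : monomial ℝ (profileWord (varParity α) 0) ∈ V := by
            simpa using add_mem (hrep []) hone
          exact add_mem h1 h1
        -- All labels of the conjugate profile are 1, whereas the first letter of any nonempty word
        -- has label 0. By symmetry the coefficient would be nonzero outside the range of profiles.
        | cons l w =>
          exfalso
          rw [← hconj] at ht
          obtain ⟨w', hw'⟩ := hrange _ ht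
          have h1 : ∀ q ∈ profileConj (profile (varParity α) 0 (l :: w)), q.2 = 1 := by
            intro q hq
            obtain ⟨⟨l', e⟩, hq', rfl⟩ := Multiset.mem_map.1 hq
            obtain ⟨p, s, hps, rfl⟩ := mem_profile _ hq'
            have : wordParity (varParity α) p = 0 :=
              wordParity_eq_zero_of_forall _ fun y hy => hev y (by simp [hps, hy])
            simp [this]
          cases w' with
          | nil => simp [profileConj] at hw'
          | cons l' w' =>
            have := h1 (l', 0) (by rw [← hw']; simp)
            exact absurd this zero_ne_one
      -- Cutting the even word just after its first odd letter leaves two odd halves, whose exchange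
      -- realizes the conjugate profile.
      · have hu : wordParity (varParity α) (p ++ [y]) = 1 := by simp [hp, hy]
        have hs : wordParity (varParity α) s = 1 := by
          simp only [wordParity_append, wordParity_cons, hp, hy] at hw
          revert hw
          generalize wordParity (varParity α) s = e
          revert e; decide
        have hsplit : p ++ y :: s = (p ++ [y]) ++ s := by simp
        rw [hsplit]
        rw [profileConj_profile_append _ hu hs]
        have := add_mem (add_mem (hrep ((p ++ [y]) ++ s)) (hrep (s ++ (p ++ [y]))))
          (hanti _ _ hu hs)
        rw [← monomial_append, ← monomial_append] at this
        convert this using 1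
        abel
    have hC : Finsupp.mapDomain profileConj C = C := by
      ext t
      have := Finsupp.mapDomain_apply
        (Function.Involutive.injective (f := profileConj) profileConj_profileConj) C (profileConj t)
      rwa [profileConj_profileConj, hconj] at this
    -- Adding the combination to its conjugate, which equals it, pairs every profile with its flip;
    -- afterwards 2 is inverted.
    have htwo : (2 : ℝ) • Finsupp.linearCombination ℝ
        (fun t => monomial ℝ (profileWord (varParity α) t)) C ∈ V := by
      have : (2 : ℝ) • Finsupp.linearCombination ℝ
          (fun t => monomial ℝ (profileWord (varParity α) t)) C =
          C.sum fun t r => r • (monomial ℝ (profileWord (varParity α) t) +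
            monomial ℝ (profileWord (varParity α) (profileConj t))) := by
        rw [two_smul]
        nth_rw 2 [← hC]
        rw [Finsupp.linearCombination_mapDomain, Finsupp.linearCombination_apply,
          Finsupp.linearCombination_apply, ← Finsupp.sum_add]
        simp only [Function.comp_apply, smul_add]
      rw [this]
      exact V.sum_mem fun t ht => V.smul_mem _ (hpair t (Finsupp.mem_support_iff.1 ht))
    exact (V.smul_mem_iff two_ne_zero).1 htwo
  · rintro f (((rfl | ⟨k₁, h₁, k₂, h₂, rfl⟩) | ⟨g₁, g₄, k₂, h₂, k₃, h₃, rfl⟩) |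
      ⟨g₁, g₅, k₂, h₂, k₃, h₃, k₄, h₄, rfl⟩) v hv
    · rw [map_one]
      exact one_mem _
    · simp only [x, map_add, map_mul, FreeAlgebra.lift_ι_apply]
      exact add_mem_center_of_odd ((hO _).1 h₁) ((hO _).1 h₂) (hv 1 k₁) (hv 2 k₂)
    · simp only [x, map_sub, map_mul, FreeAlgebra.lift_ι_apply]
      rw [mul_comm_of_even ((hE _).1 h₂) ((hE _).1 h₃) (hv 2 k₂) (hv 3 k₃), sub_self, mul_zero,
        zero_mul]
      exact zero_mem _
    · simp only [x, map_sub, map_mul, FreeAlgebra.lift_ι_apply]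
      rw [mul_reverse_of_odd ((hO _).1 h₂) ((hO _).1 h₃) ((hO _).1 h₄) (hv 2 k₂) (hv 3 k₃)
        (hv 4 k₄), sub_self, mul_zero, zero_mul]
      exact zero_mem _

/-- An isomorphism sends `a` to 1 or to 3, and the split into even and odd degrees is the same
either way. -/
theorem parity_of_addOrderOf_eq_four {a : G} (ha : addOrderOf a = 4) :
    (∀ g, g ∈ ({0, 2 • a} : Set G) ↔ parity (α g) = 0) ∧
      ∀ g, g ∈ ({a, 3 • a} : Set G) ↔ parity (α g) = 1 := by
  have hα : addOrderOf (α a) = 4 :=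
    (addOrderOf_injective α.toAddMonoidHom α.injective a).trans ha
  have h4 : α a = 1 ∨ α a = 3 := by
    have h2 : 2 • α a ≠ 0 := fun h => by
      have := addOrderOf_dvd_of_nsmul_eq_zero h
      rw [hα] at this
      exact absurd this (by decide)
    revert h2
    generalize α a = b
    revert b; decide
  have h0 : ∀ g, g ∈ ({0, 2 • a} : Set G) ↔ α g = 0 ∨ α g = 2 • α a := fun g => by
    rw [← map_nsmul, α.injective.eq_iff, ← map_zero α, α.injective.eq_iff]
    rfl
  have h1 : ∀ g, g ∈ ({a, 3 • a} : Set G) ↔ α g = α a ∨ α g = 3 • α a := fun g => by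
    rw [← map_nsmul, α.injective.eq_iff, α.injective.eq_iff]
    rfl
  refine ⟨fun g => ?_, fun g => ?_⟩
  · rw [h0]
    generalize α g = b
    rcases h4 with h | h <;> rw [h] <;> revert b <;> decide
  · rw [h1]
    generalize α g = b
    rcases h4 with h | h <;> rw [h] <;> revert b <;> decide

end Bases
end GradedPI

open GradedPI in
theorem mainTheorem5 {G : Type*} [AddGroup G] [DecidableEq G]
    (a : G) (ha : addOrderOf a = 4) (hG : ∀ g : G, g ∈ AddSubgroup.zmultiples a)
    (𝒜 : G → Submodule ℝ (Matrix (Fin 2) (Fin 2) ℂ)) [GradedAlgebra 𝒜]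
    (h𝒜 : WeaklyIsomorphic 𝒜 m2cZ4) :
    IsBasisOfIdentities 𝒜
      ({f | ∃ k₁ ∈ ({0, 2 • a} : Set G), ∃ k₂ ∈ ({0, 2 • a} : Set G),
          f = x ℝ 1 k₁ * x ℝ 2 k₂ - x ℝ 2 k₂ * x ℝ 1 k₁} ∪
       {f | ∃ h₁ ∈ ({a, 3 • a} : Set G), ∃ h₂ ∈ ({a, 3 • a} : Set G),
          ∃ h₃ ∈ ({a, 3 • a} : Set G),
          f = x ℝ 1 h₁ * x ℝ 2 h₂ * x ℝ 3 h₃ - x ℝ 3 h₃ * x ℝ 2 h₂ * x ℝ 1 h₁}) ∧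
    IsBasisOfCentralPolynomials 𝒜
      ({1} ∪
       {f | ∃ h₁ ∈ ({a, 3 • a} : Set G), ∃ h₂ ∈ ({a, 3 • a} : Set G),
          f = x ℝ 1 h₁ * x ℝ 2 h₂ + x ℝ 2 h₂ * x ℝ 1 h₁} ∪
       {f | ∃ g₁ g₄ : G, ∃ k₂ ∈ ({0, 2 • a} : Set G), ∃ k₃ ∈ ({0, 2 • a} : Set G),
          f = x ℝ 1 g₁ * (x ℝ 2 k₂ * x ℝ 3 k₃ - x ℝ 3 k₃ * x ℝ 2 k₂) * x ℝ 4 g₄} ∪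
       {f | ∃ g₁ g₅ : G, ∃ h₂ ∈ ({a, 3 • a} : Set G), ∃ h₃ ∈ ({a, 3 • a} : Set G),
          ∃ h₄ ∈ ({a, 3 • a} : Set G),
          f = x ℝ 1 g₁ *
            (x ℝ 2 h₂ * x ℝ 3 h₃ * x ℝ 4 h₄ - x ℝ 4 h₄ * x ℝ 3 h₃ * x ℝ 2 h₂) *
            x ℝ 5 g₅}) := by
  obtain ⟨α, φ, hφ⟩ := h𝒜
  obtain ⟨hE, hO⟩ := parity_of_addOrderOf_eq_four α ha
  constructor
  -- Pulling the model grading back along `α` keeps `G` as the index group, so both algebras are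
  -- tested on the same free algebra.
  · rw [IsBasisOfIdentities, gradedIdentities_eq_of_map_eq (ℬ := m2cZ4Comp α) φ hφ]
    exact isBasisOfIdentities_m2cZ4Comp α hE hO
  · rw [IsBasisOfCentralPolynomials,
      gradedCentralPolynomials_eq_of_map_eq (ℬ := m2cZ4Comp α) φ hφ]
    exact isBasisOfCentralPolynomials_m2cZ4Comp α hE hO
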